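/- **Model.** Let $N\ge 3$ and $p_0,p_1,p_2,p_3\in[0,1]$, and put $q_m:=1-p_m$. Let $\Sigma:=\{0,1\}^N$; for $x\in\Sigma$ and $i\in\{1,\dots,N\}$ (player indices modulo $N$) let $m_i(x):=2x_{i-1}+x_{i+1}$ and let $x^i$ be $x$ with its $i$th component flipped. Let $P$ be the transition matrix on $\Sigma$ with $$P(x,x^i)=\begin{cases}N^{-1}p_{m_i(x)},&x_i=0,\\ N^{-1}q_{m_i(x)},&x_i=1,\end{cases}\qquad P(x,x)=N^{-1}\Big(\sum_{i:x_i=0}q_{m_i(x)}+\sum_{i:x_i=1}p_{m_i(x)}\Big),$$ and $P(x,y)=0$ otherwise. Let $P^*$ be the transition matrix on $\Sigma^*:=\Sigma\times\{1,\dots,N\}$ with, for all $j$, $$P^*((x,i),(x^i,j))=\begin{cases}N^{-1}p_{m_i(x)},&x_i=0,\\ N^{-1}q_{m_i(x)},&x_i=1,\end{cases}\qquad P^*((x,i),(x,j))=\begin{cases}N^{-1}q_{m_i(x)},&x_i=0,\\ N^{-1}p_{m_i(x)},&x_i=1,\end{cases}$$ and $0$ otherwise. The payoff $w((x,i),(y,j))$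 of a transition is $+1$ if player $i$ wins ($y=x^i$ and $x_i=0$, or $y=x$ and $x_i=1$), and $-1$ if player $i$ loses ($y=x^i$ and $x_i=1$, or $y=x$ and $x_i=0$). The continuous-time Markov chain in $\Sigma^*$ with infinitesimal matrix $Q^*:=P^*-I$ is represented as $Y^*(t)=X^*(N(t))$, where $(X^*(n))_{n\ge0}$ is a discrete-time Markov chain with transition matrix $P^*$ and arbitrary initial distribution, and $(N(t))_{t\ge0}$ is an independent Poisson process of rate $1$. Let $S_n:=\sum_{k=1}^n w(X^*(k-1),X^*(k))$. The cumulative profit to the ensemble of $N$ players at time $t$ is $\hat S_t:=S_{N(t)}$ (so jumps from a state to itself are counted). **Theorem.** Assume that the parameters satisfy the ergodicity conditions, i.e. none of the following holds: $(p_0,p_3)=(0,1)$; $N$ is even and $(p_0,p_3)=(1,0)$; $(p_0,p_1,p_2,p_3)$ is $(1,0,0,0)$ or $(1,1,1,0)$; $3\mid N$ and either $(p_0,p_1,p_2)=(1,0,0)$ or $(p_1,p_2,p_3)=(1,1,0)$; $N=3$ and either $(p_0,p_1,p_2)=(0,1,1)$ or $(p_1,p_2,p_3)=(0,0,1)$.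 Then $P$ has a unique stationary distribution $\pi$, and, with $$\mu^N:=\frac1N\sum_{x\in\Sigma}\pi(x)\sum_{i=1}^N\big[p_{m_i(x)}-q_{m_i(x)}\big],$$ $$\lim_{t\to\infty}t^{-1}\hat S_t=\mu^N\quad\text{almost surely}.$$ Here $\mu^N$ is the mean profit per turn of the discrete-time model, i.e. $n^{-1}S_n\to\mu^N$ almost surely; moreover the two-dimensional marginals $\pi_{i,i+2}$ of $\pi$ do not depend on $i$, and for every $i$ $$\mu^N=\sum_{u=0}^1\sum_{v=0}^1\pi_{i,i+2}(u,v)\,(p_{2u+v}-q_{2u+v})=\pi_i(1)-\pi_i(0).$$ -/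

import Mathlib

open MeasureTheory ProbabilityTheory Filter Topology
open scoped NNReal

namespace Parrondo

/-- Status of the `N` players on a circle (cyclic index set `Fin N`): `0` loser, `1` winner. -/
abbrev Config (N : ℕ) := Fin N → Fin 2

/-- Status of the players together with the next player to play. -/
abbrev State (N : ℕ) := Config N × Fin N

/-- The integer `2u + v` with binary representation `(u v)`. -/
def pairIndex (u v : Fin 2) : Fin 4 := ⟨2 * u.val + v.val, by omega⟩

section

variable {N : ℕ} [NeZero N]

/-- `m_i(x) = 2 x_{i-1} + x_{i+1}`, indices modulo `N`. -/
def nbrIndex (x : Config N) (i : Fin N) : Fin 4 := pairIndex (x (i - 1)) (x (i + 1))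

/-- The configuration equal to `x` except at the component `i`. -/
def flipAt (x : Config N) (i : Fin N) : Config N := Function.update x i (1 - x i)

noncomputable section

/-- Probability that the status of player `i` changes when this player plays in configuration `x`:
a loser wins, or a winner loses. -/
def changeProb (p : Fin 4 → ℝ) (x : Config N) (i : Fin N) : ℝ :=
  if x i = 0 then p (nbrIndex x i) else 1 - p (nbrIndex x i)

/-- Probability that the status of player `i` stays the same when this player plays in
configuration `x`: a loser loses, or a winner wins. -/
def stayProb (p : Fin 4 → ℝ) (x : Config N) (i : Fin N) : ℝ :=
  if x i = 0 then 1 - p (nbrIndex x i) else p (nbrIndex x i)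

/-- One-step transition matrix of the status chain on `Config N`. For `y ≠ x` at most one term of
the second sum is nonzero. -/
def transP (p : Fin 4 → ℝ) : Matrix (Config N) (Config N) ℝ := fun x y =>
  if y = x then (N : ℝ)⁻¹ * ∑ i, stayProb p x i
  else ∑ i, if y = flipAt x i then (N : ℝ)⁻¹ * changeProb p x i else 0

/-- One-step transition matrix of the chain on `State N`: player `i` plays, and then the next player
`j` is chosen uniformly. -/
def transPstar (p : Fin 4 → ℝ) : Matrix (State N) (State N) ℝ := fun a b =>
  if b.1 = flipAt a.1 a.2 then (N : ℝ)⁻¹ * changeProb p a.1 a.2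
  else if b.1 = a.1 then (N : ℝ)⁻¹ * stayProb p a.1 a.2
  else 0

/-- Payoff of a transition: `1` if the player who plays wins, `-1` if this player loses (and `0` for
the pairs of states that are never successive). -/
def payoff (a b : State N) : ℝ :=
  if b.1 = flipAt a.1 a.2 then (if a.1 a.2 = 0 then 1 else -1)
  else if b.1 = a.1 then (if a.1 a.2 = 0 then -1 else 1)
  else 0

/-- Mean profit per turn to the ensemble when the configuration has law `ρ`. -/
def meanProfit (p : Fin 4 → ℝ) (ρ : Config N → ℝ) : ℝ :=
  (N : ℝ)⁻¹ * ∑ x, ρ x * ∑ i, (p (nbrIndex x i) - (1 - p (nbrIndex x i)))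

/-- One-dimensional marginal of `ρ`. -/
def marginal (ρ : Config N → ℝ) (i : Fin N) (u : Fin 2) : ℝ :=
  ∑ x, if x i = u then ρ x else 0

/-- Two-dimensional marginal of `ρ`. -/
def marginalPair (ρ : Config N → ℝ) (i j : Fin N) (u v : Fin 2) : ℝ :=
  ∑ x, if x i = u ∧ x j = v then ρ x else 0

end

end

/-- The parameter vectors for which the status chain is ergodic. -/
def ErgodicityConditions (N : ℕ) (p : Fin 4 → ℝ) : Prop :=
  ¬ (p 0 = 0 ∧ p 3 = 1) ∧
  ¬ (Even N ∧ p 0 = 1 ∧ p 3 = 0) ∧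
  ¬ (p 0 = 1 ∧ p 1 = 0 ∧ p 2 = 0 ∧ p 3 = 0) ∧
  ¬ (p 0 = 1 ∧ p 1 = 1 ∧ p 2 = 1 ∧ p 3 = 0) ∧
  ¬ (3 ∣ N ∧ ((p 0 = 1 ∧ p 1 = 0 ∧ p 2 = 0) ∨ (p 1 = 1 ∧ p 2 = 1 ∧ p 3 = 0))) ∧
  ¬ (N = 3 ∧ ((p 0 = 0 ∧ p 1 = 1 ∧ p 2 = 1) ∨ (p 1 = 0 ∧ p 2 = 0 ∧ p 3 = 1)))

/-- `ρ` is a probability vector with `ρ P = ρ`. -/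
def IsStationary {S : Type*} [Fintype S] (P : Matrix S S ℝ) (ρ : S → ℝ) : Prop :=
  ρ ∈ stdSimplex ℝ S ∧ Matrix.vecMul ρ P = ρ

/-- `X` is a discrete-time Markov chain with one-step transition matrix `P` (and an arbitrary
initial distribution). -/
structure IsMarkovChain {Ω S : Type*} [MeasurableSpace Ω] [MeasurableSpace S]
    (P : Matrix S S ℝ) (X : ℕ → Ω → S) (Pr : Measure Ω) : Prop where
  measurable : ∀ n, Measurable (X n)
  markov : ∀ (n : ℕ) (a : ℕ → S),
    Pr.real {ω | ∀ k ≤ n + 1, X k ω = a k} =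
      Pr.real {ω | ∀ k ≤ n, X k ω = a k} * P (a n) (a (n + 1))

/-- `T` is a Poisson process of rate `r`. Since the paths are nondecreasing, the truncated
subtraction in the increments is the actual one, almost surely. -/
structure IsPoissonProcess {Ω : Type*} [MeasurableSpace Ω]
    (r : ℝ≥0) (T : ℝ≥0 → Ω → ℕ) (Pr : Measure Ω) : Prop where
  measurable : ∀ t, Measurable (T t)
  zero : ∀ᵐ ω ∂Pr, T 0 ω = 0
  monotone : ∀ᵐ ω ∂Pr, Monotone fun t => T t ω
  rightCts : ∀ᵐ ω ∂Pr, ∀ t, ContinuousWithinAt (fun s => T s ω) (Set.Ici t) t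
  law : ∀ s t, s ≤ t → Pr.map (fun ω => T t ω - T s ω) = poissonMeasure (r * (t - s))
  indep : HasIndepIncrements T Pr

/-- The continuous-time model with infinitesimal matrix `P* - I`, in the representation in which
jumps from a state to itself are recognizable: the continuous-time chain is `t ↦ X (T t)`, where `X`
is a discrete-time chain with transition matrix `P*` and `T` an independent rate 1 Poisson process
that counts all jumps. -/
structure IsContinuousTimeModel {Ω : Type*} [MeasurableSpace Ω] {N : ℕ} [NeZero N]
    (p : Fin 4 → ℝ) (X : ℕ → Ω → State N) (T : ℝ≥0 → Ω → ℕ) (Pr : Measure Ω) : Prop where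
  chain : IsMarkovChain (transPstar p) X Pr
  poisson : IsPoissonProcess 1 T Pr
  indep : IndepFun (fun ω n => X n ω) (fun ω t => T t ω) Pr

/-- Cumulative profit `S_n` to the ensemble after `n` steps of the discrete-time chain. -/
noncomputable def cumProfit {Ω : Type*} {N : ℕ} [NeZero N] (X : ℕ → Ω → State N)
    (n : ℕ) (ω : Ω) : ℝ :=
  ∑ k ∈ Finset.range n, payoff (X k ω) (X (k + 1) ω)

/-- Cumulative profit to the ensemble at time `t` in the continuous-time model: the sum of the
payoffs of all the jumps (including those from a state to itself) up to time `t`. -/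
noncomputable def cumProfitCts {Ω : Type*} {N : ℕ} [NeZero N] (X : ℕ → Ω → State N)
    (T : ℝ≥0 → Ω → ℕ) (t : ℝ≥0) (ω : Ω) : ℝ :=
  cumProfit X (T t ω) ω

end Parrondo

namespace Parrondo

/-! ### Reachability between configurations: driving every site to one status -/

section Reach

set_option linter.unusedSectionVars false

variable {N : ℕ} [NeZero N]

/-! The ergodicity conditions are used only to produce one configuration reachable from all others
(`ErgodicityConditions.exists_reach`). Outside the case `p 0 = 1`, `p 3 = 0` a constant
configuration works, by minimizing the number of sites of one status. In that case `N` is odd, bonds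
joining equal statuses behave as particles that hop and annihilate, and every configuration reduces
to a single particle.

A globally reachable state makes harmonic functions constant (maximum principle). This gives both
solvability of Poisson's equation `g - P g = h - ρ h` and uniqueness of the stationary law;
uniqueness in turn gives rotation invariance, hence the marginal formulas.

A solution `g` for the status chain lifts to one for `transPstar`. The centred profit is then a
telescoping bounded term plus a sum of bounded martingale differences, whose second moment grows
linearly; convergence along squares and interpolation yield the discrete law of large numbers. The
same scheme, with monotonicity in place of bounded increments, gives `T t / t → 1`, and continuous
time follows from `S_T / t = (T / t) (S_T / T)`. -/

lemma eq_of_ne_of_ne {s t : Fin 2} (h : s ≠ t) {a : Fin 2} (ha : a ≠ s) : a = t := by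
  revert s t a; decide

lemma one_sub_eq_of_ne {s t : Fin 2} (h : s ≠ t) : 1 - s = t := by
  revert s t; decide

lemma one_sub_ne (a : Fin 2) : 1 - a ≠ a := by
  revert a; decide

@[simp] lemma flipAt_self (x : Config N) (i : Fin N) : flipAt x i i = 1 - x i := by
  simp [flipAt]

lemma flipAt_of_ne (x : Config N) {i j : Fin N} (h : j ≠ i) : flipAt x i j = x j := by
  simp [flipAt, h]

lemma flipAt_ne (x : Config N) (i : Fin N) : flipAt x i ≠ x := fun h =>
  one_sub_ne (x i) (by simpa using congrFun h i)

lemma smul_one_eq_zero_iff (k : ℕ) : k • (1 : Fin N) = 0 ↔ N ∣ k := by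
  obtain ⟨n, rfl⟩ := Nat.exists_eq_succ_of_ne_zero (NeZero.ne N)
  rw [show k • (1 : Fin (n + 1)) = (k : ZMod (n + 1)) from nsmul_one (A := ZMod (n + 1)) k]
  exact ZMod.natCast_eq_zero_iff k (n + 1)

lemma exists_smul_one (j : Fin N) : ∃ k < N, k • (1 : Fin N) = j := by
  obtain ⟨n, rfl⟩ := Nat.exists_eq_succ_of_ne_zero (NeZero.ne N)
  refine ⟨j.val, j.isLt, ?_⟩
  rw [show j.val • (1 : Fin (n + 1)) = (j.val : ZMod (n + 1)) from
    nsmul_one (A := ZMod (n + 1)) j.val]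
  exact ZMod.natCast_zmod_val (n := n + 1) j

/-- The two directions around the circle. -/
def IsDir (d : Fin N) : Prop := d = 1 ∨ d = -1

lemma IsDir.smul_eq_zero_iff {d : Fin N} (hd : IsDir d) (k : ℕ) : k • d = 0 ↔ N ∣ k := by
  rcases hd with rfl | rfl
  · exact smul_one_eq_zero_iff k
  · rw [smul_neg, neg_eq_zero]; exact smul_one_eq_zero_iff k

lemma IsDir.exists_smul {d : Fin N} (hd : IsDir d) (i j : Fin N) :
    ∃ k < N, i + k • d = j := by
  rcases hd with rfl | rfl
  · obtain ⟨k, hk, h⟩ := exists_smul_one (j - i)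
    exact ⟨k, hk, by rw [h]; abel⟩
  · obtain ⟨k, hk, h⟩ := exists_smul_one (i - j)
    exact ⟨k, hk, by rw [smul_neg, h]; abel⟩

lemma IsDir.smul_ne_zero {d : Fin N} (hd : IsDir d) {k : ℕ} (h0 : 0 < k) (hk : k < N) :
    k • d ≠ 0 := fun h =>
  absurd (Nat.le_of_dvd h0 ((hd.smul_eq_zero_iff k).1 h)) (by omega)

lemma IsDir.add_smul_ne {d : Fin N} (hd : IsDir d) (i : Fin N) {k l : ℕ} (hkl : k < l)
    (hl : l < k + N) : i + k • d ≠ i + l • d := by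
  intro h
  have h1 : l • d = k • d + (l - k) • d := by rw [← add_smul]; congr 1; omega
  rw [h1, ← add_assoc] at h
  exact hd.smul_ne_zero (k := l - k) (by omega) (by omega) (by simpa using h)

/-- Every configuration reaches, along `r`, one that minimizes a given weight over everything
reachable from it. -/
lemma exists_reach_minimal {S : Type*} (r : S → S → Prop) (f : S → ℕ) (x : S) :
    ∃ y, Relation.ReflTransGen r x y ∧ ∀ z, Relation.ReflTransGen r y z → f y ≤ f z := by
  obtain ⟨y, hy, hmin⟩ := WellFounded.has_min (measure f).wf
    {y | Relation.ReflTransGen r x y} ⟨x, .refl⟩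
  exact ⟨y, hy, fun z hz => not_lt.1 (hmin z (hy.trans hz))⟩

/-- The number of sites with status `t`. -/
def countSites (t : Fin 2) (x : Config N) : ℕ := (Finset.univ.filter fun i => x i = t).card

lemma countSites_flipAt_lt {t : Fin 2} {x : Config N} {i : Fin N} (h : x i = t) :
    countSites t (flipAt x i) + 1 = countSites t x := by
  unfold countSites
  have : (Finset.univ.filter fun j => flipAt x i j = t) =
      (Finset.univ.filter fun j => x j = t).erase i := by
    ext j
    by_cases hj : j = i
    · subst hj; simp [h, one_sub_ne]
    · simp [flipAt_of_ne x hj, hj]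
  rw [this, Finset.card_erase_add_one]
  simpa using h

lemma countSites_flipAt_gt {t : Fin 2} {x : Config N} {i : Fin N} (h : x i ≠ t) :
    countSites t (flipAt x i) = countSites t x + 1 := by
  have h1 : flipAt x i i = t := by
    rw [flipAt_self]; exact one_sub_eq_of_ne h
  have h2 : flipAt (flipAt x i) i = x := by
    ext j
    by_cases hj : j = i
    · subst hj; simp
    · rw [flipAt_of_ne _ hj, flipAt_of_ne _ hj]
  have := countSites_flipAt_lt h1
  rw [h2] at this
  exact this.symm

/-- `A l c r`: a player with status `c` whose neighbours have statuses `l` and `r` may change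
status. -/
def Step (A : Fin 2 → Fin 2 → Fin 2 → Prop) (x y : Config N) : Prop :=
  ∃ i, A (x (i - 1)) (x i) (x (i + 1)) ∧ y = flipAt x i

lemma step_flipAt {A : Fin 2 → Fin 2 → Fin 2 → Prop} {x : Config N} {i : Fin N}
    (h : A (x (i - 1)) (x i) (x (i + 1))) : Step A x (flipAt x i) := ⟨i, h, rfl⟩

/-- If `t` may become `s` between equal neighbours and next to one kind of mixed neighbours,
then the constant configuration `s` is reachable. -/
lemma reach_const_of_mixed {A : Fin 2 → Fin 2 → Fin 2 → Prop} {s t : Fin 2} (hst : s ≠ t)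
    (h0 : A s t s) (h3 : A t t t) (h : A s t t ∨ A t t s) (x : Config N) :
    Relation.ReflTransGen (Step A) x (fun _ => s) := by
  obtain ⟨y, hxy, hmin⟩ := exists_reach_minimal (Step A) (countSites t) x
  -- By minimality no site of status `t` in `y` may change.
  have hno : ∀ i, y i = t → ¬ A (y (i - 1)) t (y (i + 1)) := by
    intro i hi hA
    have h1 := hmin _ (.single (step_flipAt (i := i) (by rwa [hi])))
    have h2 := countSites_flipAt_lt hi
    omega
  suffices hy : y = fun _ => s by rwa [hy] at hxy
  have hs : ∀ i, y i = s := by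
    intro i
    by_contra hi
    have hi : y i = t := eq_of_ne_of_ne hst hi
    have hA := hno i hi
    rcases eq_or_ne (y (i - 1)) s with hl | hl <;> rcases eq_or_ne (y (i + 1)) s with hr | hr
    · exact hA (by rwa [hl, hr])
    · have hr := eq_of_ne_of_ne hst hr
      have hA2 := hno (i + 1) hr
      rcases h with h | h
      · exact hA (by rwa [hl, hr])
      -- Here `i + 1` has status `t` with a `t` on its left, so it may change whatever its right
      -- neighbour is.
      · rw [show i + 1 - 1 = i by abel, hi] at hA2
        rcases eq_or_ne (y (i + 1 + 1)) s with hq | hq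
        · exact hA2 (by rwa [hq])
        · exact hA2 (by rwa [eq_of_ne_of_ne hst hq])
    · have hl := eq_of_ne_of_ne hst hl
      have hA2 := hno (i - 1) hl
      rcases h with h | h
      · rw [show i - 1 + 1 = i by abel, hi] at hA2
        rcases eq_or_ne (y (i - 1 - 1)) s with hq | hq
        · exact hA2 (by rwa [hq])
        · exact hA2 (by rwa [eq_of_ne_of_ne hst hq])
      · exact hA (by rwa [hl, hr])
    · exact hA (by rwa [eq_of_ne_of_ne hst hl, eq_of_ne_of_ne hst hr])
  exact funext hs

/-- If `t` may become `s` between equal neighbours and `s` may become `t` between mixed ones, the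
constant configuration `s` is reachable unless `3 ∣ N` and `s` is stuck between two `t`. -/
lemma reach_const_of_equal {A : Fin 2 → Fin 2 → Fin 2 → Prop} {s t : Fin 2} (hst : s ≠ t)
    (hN : 4 ≤ N) (h0 : A s t s) (h3 : A t t t) (h2 : A t s s)
    (h : ¬ 3 ∣ N ∨ A t s t) (x : Config N) :
    Relation.ReflTransGen (Step A) x (fun _ => s) := by
  have hd : IsDir (1 : Fin N) := Or.inl rfl
  obtain ⟨y, hxy, hmin⟩ := exists_reach_minimal (Step A) (countSites t) x
  have hno : ∀ i, y i = t → ¬ A (y (i - 1)) t (y (i + 1)) := by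
    intro i hi hA
    have h1 := hmin _ (.single (step_flipAt (i := i) (by rwa [hi])))
    have h2 := countSites_flipAt_lt hi
    omega
  -- A minimizer has no `t` between equal neighbours, so its `t`-sites come in blocks of exactly
  -- two.
  have hnotS : ∀ i, y i = t → y (i - 1) = s → y (i + 1) = t := fun i hi hl =>
    eq_of_ne_of_ne hst fun hr => hno i hi (by rwa [hl, hr])
  have hnotT : ∀ i, y i = t → y (i - 1) = t → y (i + 1) = s := fun i hi hl =>
    eq_of_ne_of_ne hst.symm fun hr => hno i hi (by rwa [hl, hr])
  have hne : ∀ (i : Fin N) (k l : ℕ), k < l → l < k + 4 → i + k • 1 ≠ i + l • 1 :=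
    fun i k l hkl hl => hd.add_smul_ne i hkl (by omega)
  -- If the `s` closing a block `s t t s` could become `t`, then `sttt → stst → ssst` would follow:
  -- one `t` gained, two lost, against minimality.
  have hblock : ∀ i, y i = s → y (i + 1) = t → y (i + 2 • 1) = t → y (i + 3 • 1) = s →
      ¬ A t s (y (i + 4 • 1)) := by
    intro i e0 e1 e2 e3 hA
    have n01 := hne i 0 1 (by omega) (by omega)
    have n02 := hne i 0 2 (by omega) (by omega)
    have n03 := hne i 0 3 (by omega) (by omega)
    have n12 := hne i 1 2 (by omega) (by omega)
    have n13 := hne i 1 3 (by omega) (by omega)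
    have n23 := hne i 2 3 (by omega) (by omega)
    simp only [zero_smul, add_zero, one_smul] at n01 n02 n03 n12 n13
    have hs : (1 : Fin 2) - s = t := one_sub_eq_of_ne hst
    have ht : (1 : Fin 2) - t = s := one_sub_eq_of_ne hst.symm
    set y1 := flipAt y (i + 3 • 1) with hy1
    set y2 := flipAt y1 (i + 2 • 1) with hy2
    set y3 := flipAt y2 (i + 1) with hy3
    have s1 : Step A y y1 := step_flipAt (by
      rw [show i + 3 • 1 - 1 = i + 2 • (1 : Fin N) by abel,
        show i + 3 • 1 + 1 = i + 4 • (1 : Fin N) by abel, e2, e3]; exact hA)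
    have f1 : y1 (i + 1) = t := by rw [hy1, flipAt_of_ne _ n13, e1]
    have f2 : y1 (i + 2 • 1) = t := by rw [hy1, flipAt_of_ne _ n23, e2]
    have f3 : y1 (i + 3 • 1) = t := by rw [hy1, flipAt_self, e3, hs]
    have f0 : y1 i = s := by rw [hy1, flipAt_of_ne _ n03, e0]
    have s2 : Step A y1 y2 := step_flipAt (by
      rw [show i + 2 • 1 - 1 = i + (1 : Fin N) by abel,
        show i + 2 • 1 + 1 = i + 3 • (1 : Fin N) by abel, f1, f2, f3]; exact h3)
    have g1 : y2 (i + 1) = t := by rw [hy2, flipAt_of_ne _ n12, f1]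
    have g2 : y2 (i + 2 • 1) = s := by rw [hy2, flipAt_self, f2, ht]
    have g0 : y2 i = s := by rw [hy2, flipAt_of_ne _ n02, f0]
    have s3 : Step A y2 y3 := step_flipAt (by
      rw [show i + 1 - 1 = i by abel,
        show i + 1 + 1 = i + 2 • (1 : Fin N) by abel, g0, g1, g2]; exact h0)
    have c0 := hmin _ (((Relation.ReflTransGen.single s1).tail s2).tail s3)
    have c1 : countSites t y1 = countSites t y + 1 :=
      countSites_flipAt_gt (by rw [e3]; exact hst)
    have c2 : countSites t y2 + 1 = countSites t y1 := countSites_flipAt_lt f2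
    have c3 : countSites t y3 + 1 = countSites t y2 := countSites_flipAt_lt g1
    omega
  suffices hy : y = fun _ => s by rwa [hy] at hxy
  by_contra hy
  obtain ⟨j, hj⟩ : ∃ j, y j ≠ s := by
    by_contra! hall
    exact hy (funext hall)
  have hj : y j = t := eq_of_ne_of_ne hst hj
  obtain ⟨i, e0, e1⟩ : ∃ i, y i = s ∧ y (i + 1) = t := by
    rcases eq_or_ne (y (j - 1)) s with hl | hl
    · exact ⟨j - 1, hl, by rw [show j - 1 + 1 = j by abel, hj]⟩
    · have hl := eq_of_ne_of_ne hst hl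
      refine ⟨j - 1 - 1, ?_, by rw [show j - 1 - 1 + 1 = j - 1 by abel, hl]⟩
      refine eq_of_ne_of_ne hst.symm fun hq => ?_
      have := hnotT (j - 1) hl hq
      rw [show j - 1 + 1 = j by abel, hj] at this
      exact hst this.symm
  have next : ∀ i, y i = s → y (i + 1) = t → y (i + 2 • 1) = t ∧ y (i + 3 • 1) = s := by
    intro i e0 e1
    have e2 : y (i + 2 • 1) = t := by
      have := hnotS (i + 1) e1 (by rwa [show i + 1 - 1 = i by abel])
      rwa [show i + 2 • 1 = i + 1 + (1 : Fin N) by abel]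
    have e3 := hnotT (i + 2 • 1) e2 (by rwa [show i + 2 • 1 - 1 = i + (1 : Fin N) by abel])
    exact ⟨e2, by rwa [show i + 3 • 1 = i + 2 • 1 + (1 : Fin N) by abel]⟩
  have hnU : ¬ A t s t := by
    intro hA
    obtain ⟨e2, e3⟩ := next i e0 e1
    rcases eq_or_ne (y (i + 4 • 1)) s with e4 | e4
    · exact hblock i e0 e1 e2 e3 (by rwa [e4])
    · exact hblock i e0 e1 e2 e3 (by rwa [eq_of_ne_of_ne hst e4])
  have h3N : ¬ 3 ∣ N := h.resolve_right hnU
  -- By `h2` and `hblock` two consecutive `s` cannot follow a block, so the pattern `s t t` repeats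
  -- around the whole circle.
  have period : ∀ k : ℕ, y (i + (3 * k) • 1) = s ∧ y (i + (3 * k + 1) • 1) = t := by
    intro k
    induction k with
    | zero => simpa using ⟨e0, e1⟩
    | succ k ih =>
      obtain ⟨a0, a1⟩ := ih
      rw [show i + (3 * k + 1) • 1 = i + (3 * k) • 1 + (1 : Fin N) by rw [add_smul]; abel] at a1
      obtain ⟨a2, a3⟩ := next _ a0 a1
      rw [show i + (3 * (k + 1)) • 1 = i + (3 * k) • 1 + 3 • (1 : Fin N) by
        rw [mul_add, add_smul]; abel,
        show i + (3 * (k + 1) + 1) • 1 = i + (3 * k) • 1 + 4 • (1 : Fin N) by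
        rw [mul_add, add_assoc, add_smul]; abel]
      refine ⟨a3, eq_of_ne_of_ne hst fun a4 => hblock _ a0 a1 a2 a3 (by rwa [a4])⟩
  -- Inverting 3 modulo `N` makes the period 3 shift act as a shift by 1, which identifies an `s`
  -- with a `t`.
  obtain ⟨k, m, hk⟩ : ∃ k m, 3 * k = m * N + 1 := by
    have : N % 3 = 1 ∨ N % 3 = 2 := by omega
    rcases this with h | h
    · exact ⟨(2 * N + 1) / 3, 2, by omega⟩
    · exact ⟨(N + 1) / 3, 1, by omega⟩
  have hz : (m * N) • (1 : Fin N) = 0 := (smul_one_eq_zero_iff _).2 ⟨m, mul_comm _ _⟩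
  have := (period k).1
  rw [hk, add_smul, hz, zero_add, one_smul, e1] at this
  exact hst this.symm

/-! ### Equal bonds as hopping and annihilating particles -/

/-- The set of bonds in direction `d` that join equal statuses. -/
def equalBonds (d : Fin N) (x : Config N) : Finset (Fin N) :=
  Finset.univ.filter fun i => x i = x (i + d)

lemma mem_equalBonds {d : Fin N} {x : Config N} {i : Fin N} :
    i ∈ equalBonds d x ↔ x i = x (i + d) := by simp [equalBonds]

lemma eq_one_sub_iff (a b : Fin 2) : a = 1 - b ↔ a ≠ b := by revert a b; decide

lemma one_sub_eq_iff (a b : Fin 2) : 1 - a = b ↔ a ≠ b := by revert a b; decide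

lemma mem_equalBonds_flipAt_left {d : Fin N} (hd : d ≠ 0) (x : Config N) (i : Fin N) :
    i ∈ equalBonds d (flipAt x (i + d)) ↔ i ∉ equalBonds d x := by
  rw [mem_equalBonds, mem_equalBonds, flipAt_self, flipAt_of_ne, eq_one_sub_iff]
  simpa using hd

lemma mem_equalBonds_flipAt_right {d : Fin N} (hd : d ≠ 0) (x : Config N) (i : Fin N) :
    i ∈ equalBonds d (flipAt x i) ↔ i ∉ equalBonds d x := by
  rw [mem_equalBonds, mem_equalBonds, flipAt_self, flipAt_of_ne, one_sub_eq_iff]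
  simpa using hd

lemma mem_equalBonds_flipAt_of_ne {d : Fin N} (x : Config N) {i j : Fin N}
    (h1 : j ≠ i) (h2 : j + d ≠ i) :
    j ∈ equalBonds d (flipAt x i) ↔ j ∈ equalBonds d x := by
  rw [mem_equalBonds, mem_equalBonds, flipAt_of_ne x h1, flipAt_of_ne x h2]

/-- Flipping a site toggles exactly its two bonds: a particle next to an empty bond hops. -/
lemma equalBonds_flipAt_move {d : Fin N} (hd : d ≠ 0) {x : Config N} {i : Fin N}
    (h1 : i ∈ equalBonds d x) (h2 : i + d ∉ equalBonds d x) :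
    equalBonds d (flipAt x (i + d)) = insert (i + d) ((equalBonds d x).erase i) := by
  ext j
  rw [Finset.mem_insert, Finset.mem_erase]
  by_cases hj : j = i + d
  · subst hj
    simp [mem_equalBonds_flipAt_right hd, h2]
  · by_cases hji : j = i
    · subst hji
      simp [mem_equalBonds_flipAt_left hd, h1, hd]
    · rw [mem_equalBonds_flipAt_of_ne x hj (by simpa using hji)]
      simp [hj, hji]

/-- Both toggled bonds are occupied: the two particles annihilate. -/
lemma equalBonds_flipAt_card_lt {d : Fin N} (hd : d ≠ 0) {x : Config N} {i : Fin N}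
    (h1 : i ∈ equalBonds d x) (h2 : i + d ∈ equalBonds d x) :
    (equalBonds d (flipAt x (i + d))).card < (equalBonds d x).card := by
  refine Finset.card_lt_card ((Finset.ssubset_iff_of_subset ?_).2 ⟨i, h1, ?_⟩)
  · intro j hj
    by_cases hj1 : j = i + d
    · rwa [hj1]
    · by_cases hji : j = i
      · rwa [hji]
      · rwa [mem_equalBonds_flipAt_of_ne x hj1 (by simpa using hji)] at hj
  · rw [mem_equalBonds_flipAt_left hd]; simpa using h1

/-- Induction on the distance `k`: the particle at `i` hops towards the other one, keeping the
number of particles, until it meets a particle and annihilates. The bound `k < N` keeps the two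
bonds distinct. -/
lemma reach_fewer_bonds {r : Config N → Config N → Prop} {d : Fin N} (hd : IsDir d)
    (hr : ∀ x i, i ∈ equalBonds d x → r x (flipAt x (i + d))) (k : ℕ) :
    ∀ (x : Config N) (i : Fin N), 0 < k → k < N → i ∈ equalBonds d x →
      i + k • d ∈ equalBonds d x →
      ∃ y, Relation.ReflTransGen r x y ∧ (equalBonds d y).card < (equalBonds d x).card := by
  induction k with
  | zero => intro x i h; omega
  | succ k ih =>
    intro x i _ hk hi hj
    have hd0 : d ≠ 0 := by simpa using hd.smul_ne_zero (k := 1) one_pos (by omega)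
    by_cases h1 : i + d ∈ equalBonds d x
    · exact ⟨_, .single (hr x i hi), equalBonds_flipAt_card_lt hd0 hi h1⟩
    · have hk0 : 0 < k := by
        rcases Nat.eq_zero_or_pos k with rfl | h
        · simp [h1] at hj
        · exact h
      have hB := equalBonds_flipAt_move hd0 hi h1
      have hne : i + (k + 1) • d ≠ i := by
        simpa using hd.smul_ne_zero (k := k + 1) (by omega) hk
      obtain ⟨y, hy, hlt⟩ := ih (flipAt x (i + d)) (i + d) hk0 (by omega) (by simp [hB])
        (by
          rw [hB, show i + d + k • d = i + (k + 1) • d by rw [add_smul, one_smul]; abel]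
          exact Finset.mem_insert_of_mem (Finset.mem_erase.2 ⟨hne, hj⟩))
      refine ⟨y, .head (hr x i hi) hy, ?_⟩
      rwa [hB, Finset.card_insert_of_notMem (by simp [h1]), Finset.card_erase_add_one hi] at hlt

/-- Without equal bonds the statuses alternate, which is impossible around an odd cycle. -/
lemma equalBonds_nonempty {d : Fin N} (hodd : Odd N) (hd : IsDir d) (x : Config N) :
    (equalBonds d x).Nonempty := by
  by_contra h
  rw [Finset.not_nonempty_iff_eq_empty] at h
  have hne : ∀ i, x (i + d) = 1 - x i := fun i => by
    rw [eq_one_sub_iff]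
    intro hi
    have : i ∈ equalBonds d x := mem_equalBonds.2 hi.symm
    simp [h] at this
  have halt : ∀ k : ℕ, x (0 + (2 * k + 1) • d) = 1 - x 0 := by
    intro k
    induction k with
    | zero => simpa using hne 0
    | succ k ih =>
      rw [show 0 + (2 * (k + 1) + 1) • d = 0 + (2 * k + 1) • d + d + d by
        rw [mul_add, add_smul, add_smul, add_smul]; abel, hne, hne, ih]
      simp
  obtain ⟨k, hk⟩ := hodd
  have := halt k
  rw [← hk, (hd.smul_eq_zero_iff N).2 dvd_rfl, add_zero] at this
  exact one_sub_ne _ this.symm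

/-- The bonds determine a configuration up to a global flip, which the status of one site settles.
-/
lemma eq_of_equalBonds_eq {d : Fin N} (hd : IsDir d) {x y : Config N} {e : Fin N}
    (h : equalBonds d x = equalBonds d y) (he : x e = y e) : x = y := by
  have hk : ∀ k : ℕ, x (e + k • d) = y (e + k • d) := by
    intro k
    induction k with
    | zero => simpa using he
    | succ k ih =>
      rw [show e + (k + 1) • d = e + k • d + d by rw [add_smul, one_smul]; abel]
      have h1 := mem_equalBonds (d := d) (x := x) (i := e + k • d)
      have h2 := mem_equalBonds (d := d) (x := y) (i := e + k • d)
      rw [h, h2, ih] at h1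
      have key : ∀ a b c : Fin 2, (c = b ↔ c = a) → a = b := by decide
      exact key _ _ _ h1
  ext1 j
  obtain ⟨k, -, rfl⟩ := hd.exists_smul e j
  exact hk k

/-- Each hop flips the site ahead, which agreed with the particle's site; hence the status seen at
the particle alternates. -/
lemma reach_moved_bond {r : Config N → Config N → Prop} {d : Fin N} (hd0 : d ≠ 0)
    (hr : ∀ x i, i ∈ equalBonds d x → r x (flipAt x (i + d)))
    {x : Config N} {i : Fin N} (hx : equalBonds d x = {i}) (k : ℕ) :
    ∃ y, Relation.ReflTransGen r x y ∧ equalBonds d y = {i + k • d} ∧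
      y (i + k • d) = if Even k then x i else 1 - x i := by
  induction k with
  | zero => exact ⟨x, .refl, by simpa using hx, by simp⟩
  | succ k ih =>
    obtain ⟨y, hxy, hy, hv⟩ := ih
    have e1 : i + (k + 1) • d = i + k • d + d := by rw [add_smul, one_smul]; abel
    have hm : i + k • d ∈ equalBonds d y := by simp [hy]
    refine ⟨flipAt y (i + k • d + d), hxy.tail (hr _ _ hm), ?_, ?_⟩
    · rw [equalBonds_flipAt_move hd0 hm (by simp [hy, hd0]), hy, e1]
      simp
    · rw [e1, flipAt_self, ← mem_equalBonds.1 hm, hv]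
      by_cases hk : Even k <;> simp [hk, Nat.even_add_one]

/-- If particles (equal bonds) can move and annihilate and `N` is odd, some configuration is
reachable from all others. -/
lemma exists_reach_of_particles {r : Config N → Config N → Prop} {d : Fin N} (hN : 2 ≤ N)
    (hodd : Odd N) (hd : IsDir d)
    (hr : ∀ x i, i ∈ equalBonds d x → r x (flipAt x (i + d))) :
    ∃ z, ∀ x, Relation.ReflTransGen r x z := by
  have hd0 : d ≠ 0 := by simpa using hd.smul_ne_zero (k := 1) one_pos (by omega)
  have single : ∀ x, ∃ y i, Relation.ReflTransGen r x y ∧ equalBonds d y = {i} := by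
    intro x
    obtain ⟨y, hxy, hmin⟩ := exists_reach_minimal r (fun y => (equalBonds d y).card) x
    obtain ⟨i, hi⟩ := equalBonds_nonempty hodd hd y
    refine ⟨y, i, hxy, Finset.eq_singleton_iff_unique_mem.2 ⟨hi, fun j hj => ?_⟩⟩
    by_contra hne
    obtain ⟨k, hk, rfl⟩ := hd.exists_smul i j
    have hk0 : 0 < k := Nat.pos_of_ne_zero fun h => hne (by simp [h])
    obtain ⟨w, hw, hlt⟩ := reach_fewer_bonds hd hr k y i hk0 hk hi hj
    exact absurd (hmin w hw) (by simpa using hlt)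
  obtain ⟨z, e, -, hz⟩ := single fun _ => 0
  refine ⟨z, fun x => ?_⟩
  obtain ⟨y, i, hxy, hy⟩ := single x
  obtain ⟨k, -, hk⟩ := hd.exists_smul i e
  -- One more full turn leads to the same bond; since `N` is odd, the parity of the number of hops
  -- changes and the two outcomes are complementary. One of them is `z`.
  have hk' : i + (k + N) • d = e := by
    rw [add_smul, (hd.smul_eq_zero_iff N).2 dvd_rfl, add_zero, hk]
  obtain ⟨w, hw, hwB, hwv⟩ := reach_moved_bond hd0 hr hy k
  obtain ⟨w', hw', hwB', hwv'⟩ := reach_moved_bond hd0 hr hy (k + N)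
  rw [hk] at hwB hwv
  rw [hk'] at hwB' hwv'
  have : w e ≠ w' e := by
    rw [hwv, hwv']
    rcases Nat.even_or_odd k with h | h
    · have : ¬ Even (k + N) := Nat.not_even_iff_odd.2 (h.add_odd hodd)
      simpa [h, this] using (one_sub_ne (y i)).symm
    · have : Even (k + N) := h.add_odd hodd
      simpa [Nat.not_even_iff_odd.2 h, this] using one_sub_ne (y i)
  rcases eq_or_ne (w e) (z e) with h | h
  · rw [← eq_of_equalBonds_eq hd (hwB.trans hz.symm) h]
    exact hxy.trans hw
  · have h' : w' e = z e := (eq_of_ne_of_ne this.symm.symm this.symm).trans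
      (eq_of_ne_of_ne this (Ne.symm h)).symm
    rw [← eq_of_equalBonds_eq hd (hwB'.trans hz.symm) h']
    exact hxy.trans hw'

end Reach

/-! ### Case analysis on the parameters -/

/-- A player with status `c` and neighbours `l`, `r` changes status with positive probability. -/
def MayChange (p : Fin 4 → ℝ) (l c r : Fin 2) : Prop :=
  0 < if c = 0 then p (pairIndex l r) else 1 - p (pairIndex l r)

/-- Under the ergodicity conditions some configuration is reachable from all others. -/
theorem ErgodicityConditions.exists_reach {N : ℕ} [NeZero N] (hN : 3 ≤ N) {p : Fin 4 → ℝ}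
    (hp : ∀ m, p m ∈ Set.Icc (0 : ℝ) 1) (herg : ErgodicityConditions N p) :
    ∃ z : Config N, ∀ x, Relation.ReflTransGen (Step (MayChange p)) x z := by
  obtain ⟨e1, e2, e3, e4, e5, e6⟩ := herg
  have up : ∀ {m}, p m ≠ 0 → 0 < p m := fun {m} h => lt_of_le_of_ne (hp m).1 h.symm
  have down : ∀ {m}, p m ≠ 1 → 0 < 1 - p m := fun {m} h =>
    sub_pos.2 (lt_of_le_of_ne (hp m).2 h)
  have h01 : (0 : Fin 2) ≠ 1 := by decide
  have h1 : ∀ {m}, p m = 1 → 0 < p m := fun h => by rw [h]; exact one_pos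
  have h0 : ∀ {m}, p m = 0 → 0 < 1 - p m := fun h => by rw [h]; norm_num
  have n1 : ∀ {m}, p m = 1 → p m ≠ 0 := fun h => by rw [h]; norm_num
  have n0 : ∀ {m}, p m = 0 → p m ≠ 1 := fun h => by rw [h]; norm_num
  have lo : p 0 ≠ 1 → p 3 ≠ 1 → p 1 ≠ 1 ∨ p 2 ≠ 1 →
      ∃ z : Config N, ∀ x, Relation.ReflTransGen (Step (MayChange p)) x z := fun a b c =>
    ⟨_, reach_const_of_mixed h01 (down a) (down b) (c.imp (fun h => down h) fun h => down h)⟩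
  have hi : p 0 ≠ 0 → p 3 ≠ 0 → p 1 ≠ 0 ∨ p 2 ≠ 0 →
      ∃ z : Config N, ∀ x, Relation.ReflTransGen (Step (MayChange p)) x z := fun a b c =>
    ⟨_, reach_const_of_mixed h01.symm (up b) (up a) (c.symm.imp (fun h => up h) fun h => up h)⟩
  by_cases c1 : p 0 ≠ 1 ∧ p 3 ≠ 1
  · by_cases c2 : p 1 ≠ 1 ∨ p 2 ≠ 1
    · exact lo c1.1 c1.2 c2
    · push Not at c2
      by_cases c3 : 4 ≤ N ∧ (¬ 3 ∣ N ∨ p 3 ≠ 0)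
      · exact ⟨_, reach_const_of_equal h01 c3.1 (down c1.1) (down c1.2) (h1 c2.2)
          (c3.2.imp_right fun h => up h)⟩
      · have d3 : 3 ∣ N := by
          by_contra h
          exact c3 ⟨by omega, Or.inl h⟩
        have p3 : p 3 ≠ 0 := fun h => e5 ⟨d3, Or.inr ⟨c2.1, c2.2, h⟩⟩
        -- Only `N = 3` is left; the constant configuration 1 then takes over, the needed `p 0 ≠ 0`
        -- coming from `e6`.
        have N3 : N = 3 := by
          by_contra h
          exact c3 ⟨by omega, Or.inr p3⟩
        exact hi (fun h => e6 ⟨N3, Or.inl ⟨h, c2⟩⟩) p3 (Or.inl (n1 c2.1))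
  -- The mirror case, with the two statuses exchanged.
  by_cases c1' : p 0 ≠ 0 ∧ p 3 ≠ 0
  · by_cases c2 : p 1 ≠ 0 ∨ p 2 ≠ 0
    · exact hi c1'.1 c1'.2 c2
    · push Not at c2
      by_cases c3 : 4 ≤ N ∧ (¬ 3 ∣ N ∨ p 0 ≠ 1)
      · exact ⟨_, reach_const_of_equal h01.symm c3.1 (up c1'.2) (up c1'.1) (h0 c2.1)
          (c3.2.imp_right fun h => down h)⟩
      · have d3 : 3 ∣ N := by
          by_contra h
          exact c3 ⟨by omega, Or.inl h⟩
        have p0 : p 0 ≠ 1 := fun h => e5 ⟨d3, Or.inl ⟨h, c2.1, c2.2⟩⟩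
        have N3 : N = 3 := by
          by_contra h
          exact c3 ⟨by omega, Or.inr p0⟩
        exact lo p0 (fun h => e6 ⟨N3, Or.inr ⟨c2.1, c2.2, h⟩⟩) (Or.inl (n0 c2.1))
  have q : p 0 = 1 ∧ p 3 = 0 := by
    by_cases a : p 0 = 0
    · exact absurd ⟨n0 a, fun b => e1 ⟨a, b⟩⟩ c1
    · have b : p 3 = 0 := by
        by_contra b
        exact c1' ⟨a, b⟩
      refine ⟨?_, b⟩
      by_contra a'
      exact c1 ⟨a', n0 b⟩
  have hodd : Odd N := Nat.not_even_iff_odd.1 fun h => e2 ⟨h, q⟩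
  -- Any player agreeing with the left neighbour may change exactly under this condition; otherwise
  -- `e3` and `e4` allow the same with the right neighbour.
  by_cases c4 : p 1 ≠ 0 ∧ p 2 ≠ 1
  · refine exists_reach_of_particles (d := 1) (by omega) hodd (Or.inl rfl) fun x i hi =>
      step_flipAt ?_
    rw [add_sub_cancel_right, mem_equalBonds.1 hi]
    have key : ∀ a b : Fin 2, MayChange p a a b := by
      intro a b
      fin_cases a <;> fin_cases b
      exacts [h1 q.1, up c4.1, down c4.2, h0 q.2]
    exact key _ _
  · have c5 : p 2 ≠ 0 ∧ p 1 ≠ 1 := by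
      by_cases a : p 1 = 0
      · exact ⟨fun b => e3 ⟨q.1, a, b, q.2⟩, n0 a⟩
      · have b : p 2 = 1 := by
          by_contra b
          exact c4 ⟨a, b⟩
        exact ⟨n1 b, fun a => e4 ⟨q.1, a, b, q.2⟩⟩
    refine exists_reach_of_particles (d := -1) (by omega) hodd (Or.inr rfl) fun x i hi =>
      step_flipAt ?_
    rw [show i + -1 + 1 = i by abel, mem_equalBonds.1 hi]
    have key : ∀ a b : Fin 2, MayChange p b a a := by
      intro a b
      fin_cases a <;> fin_cases b
      exacts [h1 q.1, up c5.1, down c5.2, h0 q.2]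
    exact key _ _

/-! ### Finite stochastic matrices: harmonic functions, stationarity, Poisson's equation -/

section Stochastic

variable {S : Type*} [Fintype S] {P : Matrix S S ℝ}

/-- A function is at most its value at a globally reachable state if it is harmonic. -/
lemma harmonic_le (hnn : ∀ x y, 0 ≤ P x y) (hrow : ∀ x, ∑ y, P x y = 1) {z : S}
    (hz : ∀ x, Relation.ReflTransGen (fun x y => 0 < P x y) x z) {f : S → ℝ}
    (hf : ∀ x, ∑ y, P x y * f y = f x) (x : S) : f x ≤ f z := by
  have : Nonempty S := ⟨z⟩
  obtain ⟨m, hm⟩ := Finite.exists_max f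
  have hstep : ∀ a b, 0 < P a b → f a = f m → f b = f m := by
    intro a b hab ha
    -- At a maximizer the nonnegative gaps average to zero, so every successor is a maximizer too.
    have h0 : ∑ y, P a y * (f m - f y) = 0 := by
      simp only [mul_sub, Finset.sum_sub_distrib, ← Finset.sum_mul, hrow, hf, ha]
      ring
    have := (Finset.sum_eq_zero_iff_of_nonneg fun y _ =>
      mul_nonneg (hnn a y) (sub_nonneg.2 (hm y))).1 h0 b (Finset.mem_univ b)
    rcases mul_eq_zero.1 this with h | h
    · exact absurd h hab.ne'
    · linarith
  have : f z = f m := by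
    have hzm := hz m
    clear hz
    induction hzm with
    | refl => rfl
    | tail _ h ih => exact hstep _ _ h ih
  rw [this]
  exact hm x

lemma harmonic_eq (hnn : ∀ x y, 0 ≤ P x y) (hrow : ∀ x, ∑ y, P x y = 1) {z : S}
    (hz : ∀ x, Relation.ReflTransGen (fun x y => 0 < P x y) x z) {f : S → ℝ}
    (hf : ∀ x, ∑ y, P x y * f y = f x) (x : S) : f x = f z := by
  refine le_antisymm (harmonic_le hnn hrow hz hf x) ?_
  have := harmonic_le (f := fun x => - f x) hnn hrow hz (fun x => by simp [hf]) x
  linarith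

lemma isStationary_iff {ρ : S → ℝ} : IsStationary P ρ ↔
    (∀ x, 0 ≤ ρ x) ∧ ∑ x, ρ x = 1 ∧ ∀ y, ∑ x, ρ x * P x y = ρ y := by
  simp only [IsStationary, stdSimplex, Set.mem_ofPred_eq, and_assoc, funext_iff, Matrix.vecMul,
    dotProduct]

lemma IsStationary.sum_mul {ρ : S → ℝ} (h : IsStationary P ρ) (f : S → ℝ) :
    ∑ x, ρ x * ∑ y, P x y * f y = ∑ y, ρ y * f y := by
  simp only [Finset.mul_sum]
  rw [Finset.sum_comm]
  refine Finset.sum_congr rfl fun y _ => ?_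
  rw [← (isStationary_iff.1 h).2.2 y, Finset.sum_mul]
  exact Finset.sum_congr rfl fun x _ => by ring

/-- A finite stochastic matrix has a stationary distribution. -/
lemma exists_isStationary [Nonempty S] (hnn : ∀ x y, 0 ≤ P x y) (hrow : ∀ x, ∑ y, P x y = 1) :
    ∃ ρ, IsStationary P ρ := by
  classical
  have hdet : (1 - P).det = 0 := by
    refine Matrix.exists_mulVec_eq_zero_iff.1 ⟨fun _ => 1, ?_, ?_⟩
    · obtain ⟨x⟩ := ‹Nonempty S›
      exact fun h => one_ne_zero (congrFun h x)
    · ext x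
      rw [Matrix.sub_mulVec, Matrix.one_mulVec]
      simp [Matrix.mulVec, dotProduct, hrow]
  obtain ⟨v, hv0, hv⟩ := Matrix.exists_vecMul_eq_zero_iff.2 hdet
  have hv : ∀ y, v y = ∑ x, v x * P x y := fun y => by
    have := congrFun hv y
    rw [Matrix.vecMul_sub, Matrix.vecMul_one] at this
    exact sub_eq_zero.1 this
  -- The absolute value of a left fixed vector is subinvariant; both sides have the same total mass,
  -- so equality holds and `|v|` can be normalized.
  have hle : ∀ y, |v y| ≤ ∑ x, |v x| * P x y := fun y => by
    conv_lhs => rw [hv y]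
    refine (Finset.abs_sum_le_sum_abs _ _).trans (Finset.sum_le_sum fun x _ => ?_)
    rw [abs_mul, abs_of_nonneg (hnn x y)]
  have htot : ∑ y, ∑ x, |v x| * P x y = ∑ y, |v y| := by
    rw [Finset.sum_comm]
    simp [← Finset.mul_sum, hrow]
  have heq : ∀ y, |v y| = ∑ x, |v x| * P x y := fun y =>
    (Finset.sum_eq_sum_iff_of_le fun y _ => hle y).1 htot.symm y (Finset.mem_univ y)
  have hpos : 0 < ∑ y, |v y| := by
    obtain ⟨x, hx⟩ := Function.ne_iff.1 hv0
    exact Finset.sum_pos' (fun _ _ => abs_nonneg _) ⟨x, Finset.mem_univ x, abs_pos.2 hx⟩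
  refine ⟨fun x => |v x| / ∑ y, |v y|, isStationary_iff.2 ⟨fun x => by positivity, ?_, ?_⟩⟩
  · rw [← Finset.sum_div, div_self hpos.ne']
  · intro y
    rw [heq y, Finset.sum_div]
    exact Finset.sum_congr rfl fun x _ => by ring

/-- If one state is reachable from all others, Poisson's equation is solvable. -/
lemma IsStationary.exists_poisson (hnn : ∀ x y, 0 ≤ P x y) (hrow : ∀ x, ∑ y, P x y = 1) {z : S}
    (hz : ∀ x, Relation.ReflTransGen (fun x y => 0 < P x y) x z) {ρ : S → ℝ}
    (hρ : IsStationary P ρ) (h : S → ℝ) :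
    ∃ g : S → ℝ, ∀ x, g x - ∑ y, P x y * g y = h x - ∑ y, ρ y * h y := by
  have hsum := (isStationary_iff.1 hρ).2.1
  -- The rank one term `ρ g` removes the constants from the kernel of `I - P`. In finite dimension
  -- injectivity then gives surjectivity, and `L` preserves the integral against `ρ`.
  let L : (S → ℝ) →ₗ[ℝ] (S → ℝ) :=
    { toFun := fun g x => g x - ∑ y, P x y * g y + ∑ y, ρ y * g y
      map_add' := fun f g => by
        ext x
        simp only [Pi.add_apply, mul_add, Finset.sum_add_distrib]
        ring
      map_smul' := fun c g => by
        ext x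
        simp only [Pi.smul_apply, smul_eq_mul, RingHom.id_apply, mul_add, mul_sub,
          Finset.mul_sum]
        simp only [mul_left_comm] }
  have hint : ∀ g, ∑ x, ρ x * L g x = ∑ y, ρ y * g y := fun g => by
    have : ∀ x, ρ x * L g x = ρ x * g x - ρ x * ∑ y, P x y * g y + ρ x * ∑ y, ρ y * g y :=
      fun x => by simp only [L, LinearMap.coe_mk, AddHom.coe_mk]; ring
    simp only [this, Finset.sum_add_distrib, Finset.sum_sub_distrib, hρ.sum_mul,
      ← Finset.sum_mul, hsum]
    ring
  have hinj : Function.Injective L := by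
    rw [injective_iff_map_eq_zero]
    intro g hg
    have h0 : ∑ y, ρ y * g y = 0 := by rw [← hint g, hg]; simp
    have hharm : ∀ x, ∑ y, P x y * g y = g x := fun x => by
      have := congrFun hg x
      simp only [L, LinearMap.coe_mk, AddHom.coe_mk, h0, Pi.zero_apply] at this
      linarith
    have hc := harmonic_eq hnn hrow hz hharm
    have : g z = 0 := by
      simp only [hc, ← Finset.sum_mul, hsum] at h0
      linarith
    ext x
    rw [hc x, this, Pi.zero_apply]
  obtain ⟨g, hg⟩ := LinearMap.injective_iff_surjective.1 hinj h
  refine ⟨g, fun x => ?_⟩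
  rw [← hg, hint g]
  simp only [L, LinearMap.coe_mk, AddHom.coe_mk]
  ring

/-- Integrating Poisson's equation for the indicator of `a` against `ρ'` gives `0 = ρ' a - ρ a`. -/
lemma IsStationary.unique (hnn : ∀ x y, 0 ≤ P x y) (hrow : ∀ x, ∑ y, P x y = 1) {z : S}
    (hz : ∀ x, Relation.ReflTransGen (fun x y => 0 < P x y) x z) {ρ ρ' : S → ℝ}
    (hρ : IsStationary P ρ) (hρ' : IsStationary P ρ') : ρ' = ρ := by
  classical
  ext a
  obtain ⟨g, hg⟩ := hρ.exists_poisson hnn hrow hz fun x => if x = a then 1 else 0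
  have h1 : ∑ x, ρ' x * (g x - ∑ y, P x y * g y) = 0 := by
    simp only [mul_sub, Finset.sum_sub_distrib, hρ'.sum_mul, sub_self]
  simp only [hg, mul_sub, Finset.sum_sub_distrib, ← Finset.sum_mul,
    (isStationary_iff.1 hρ').2.1] at h1
  simp at h1
  linarith

end Stochastic

/-! ### The transition matrix of the status chain -/

section StatusChain

variable {N : ℕ} [NeZero N] {p : Fin 4 → ℝ}

lemma natCast_inv_mul_sum_const (c : ℝ) : (N : ℝ)⁻¹ * ∑ _i : Fin N, c = c := by
  have : (N : ℝ) ≠ 0 := Nat.cast_ne_zero.2 (NeZero.ne N)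
  simp [this]

lemma changeProb_add_stayProb (p : Fin 4 → ℝ) (x : Config N) (i : Fin N) :
    changeProb p x i + stayProb p x i = 1 := by
  unfold changeProb stayProb
  split_ifs <;> ring

lemma changeProb_nonneg (hp : ∀ m, p m ∈ Set.Icc (0 : ℝ) 1) (x : Config N) (i : Fin N) :
    0 ≤ changeProb p x i := by
  unfold changeProb
  split_ifs
  · exact (hp _).1
  · exact sub_nonneg.2 (hp _).2

lemma stayProb_nonneg (hp : ∀ m, p m ∈ Set.Icc (0 : ℝ) 1) (x : Config N) (i : Fin N) :
    0 ≤ stayProb p x i := by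
  unfold stayProb
  split_ifs
  · exact sub_nonneg.2 (hp _).2
  · exact (hp _).1

/-- A flip never returns `x`, so diagonal and off-diagonal entries share one formula. -/
lemma transP_eq (p : Fin 4 → ℝ) (x y : Config N) :
    transP p x y = (N : ℝ)⁻¹ * ∑ i, ((if y = flipAt x i then changeProb p x i else 0) +
      if y = x then stayProb p x i else 0) := by
  unfold transP
  split_ifs with h
  · subst h
    congr 1
    exact Finset.sum_congr rfl fun i _ => by rw [if_neg (flipAt_ne y i).symm, zero_add]
  · rw [Finset.mul_sum]
    exact Finset.sum_congr rfl fun i _ => by split_ifs <;> simp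

lemma sum_transP_mul (p : Fin 4 → ℝ) (x : Config N) (f : Config N → ℝ) :
    ∑ y, transP p x y * f y =
      (N : ℝ)⁻¹ * ∑ i, (changeProb p x i * f (flipAt x i) + stayProb p x i * f x) := by
  simp only [transP_eq, mul_assoc, ← Finset.mul_sum, Finset.sum_mul]
  rw [Finset.sum_comm]
  congr 1
  refine Finset.sum_congr rfl fun i _ => ?_
  simp [add_mul, Finset.sum_add_distrib, ite_mul]

lemma sum_transP (p : Fin 4 → ℝ) (x : Config N) : ∑ y, transP p x y = 1 := by
  have := sum_transP_mul p x fun _ => 1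
  simpa only [mul_one, changeProb_add_stayProb, natCast_inv_mul_sum_const] using this

lemma transP_nonneg (hp : ∀ m, p m ∈ Set.Icc (0 : ℝ) 1) (x y : Config N) :
    0 ≤ transP p x y := by
  rw [transP_eq]
  refine mul_nonneg (by positivity) (Finset.sum_nonneg fun i _ => add_nonneg ?_ ?_)
  · split_ifs
    exacts [changeProb_nonneg hp x i, le_rfl]
  · split_ifs
    exacts [stayProb_nonneg hp x i, le_rfl]

lemma transP_pos_of_step (hp : ∀ m, p m ∈ Set.Icc (0 : ℝ) 1) {x y : Config N}
    (h : Step (MayChange p) x y) : 0 < transP p x y := by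
  obtain ⟨i, hi, rfl⟩ := h
  have hN : 0 < (N : ℝ) := Nat.cast_pos.2 (Nat.pos_of_ne_zero (NeZero.ne N))
  rw [transP_eq]
  refine mul_pos (inv_pos.2 hN) (Finset.sum_pos' (fun j _ => add_nonneg ?_ ?_)
    ⟨i, Finset.mem_univ i, ?_⟩)
  · split_ifs
    exacts [changeProb_nonneg hp x j, le_rfl]
  · split_ifs
    exacts [stayProb_nonneg hp x j, le_rfl]
  · rw [if_pos rfl, if_neg (flipAt_ne x i), add_zero]
    exact hi

lemma ErgodicityConditions.exists_reach_transP (hN : 3 ≤ N)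
    (hp : ∀ m, p m ∈ Set.Icc (0 : ℝ) 1) (herg : ErgodicityConditions N p) :
    ∃ z : Config N, ∀ x, Relation.ReflTransGen (fun x y => 0 < transP p x y) x z := by
  obtain ⟨z, hz⟩ := herg.exists_reach hN hp
  exact ⟨z, fun x => (hz x).lift id fun _ _ => transP_pos_of_step hp⟩

/-! ### Rotation invariance, marginals and mean profit -/

/-- Rotation of the circle. -/
def rotate (c : Fin N) : Config N ≃ Config N :=
  (Equiv.addRight c).symm.arrowCongr (Equiv.refl (Fin 2))

@[simp] lemma rotate_apply (c : Fin N) (x : Config N) (i : Fin N) :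
    rotate c x i = x (i + c) := rfl

lemma flipAt_rotate (c : Fin N) (x : Config N) (i : Fin N) :
    flipAt (rotate c x) i = rotate c (flipAt x (i + c)) := by
  ext1 j
  by_cases h : j = i
  · subst h; simp
  · rw [flipAt_of_ne _ h, rotate_apply, rotate_apply, flipAt_of_ne _ (by simpa using h)]

lemma nbrIndex_rotate (c : Fin N) (x : Config N) (i : Fin N) :
    nbrIndex (rotate c x) i = nbrIndex x (i + c) := by
  simp only [nbrIndex, rotate_apply, sub_add_eq_add_sub, add_right_comm]

lemma transP_rotate (p : Fin 4 → ℝ) (c : Fin N) (x y : Config N) :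
    transP p (rotate c x) (rotate c y) = transP p x y := by
  rw [transP_eq, transP_eq]
  congr 1
  refine Eq.trans ?_ (Equiv.sum_comp (Equiv.addRight c) _)
  refine Finset.sum_congr rfl fun i _ => ?_
  simp only [flipAt_rotate, (rotate c).apply_eq_iff_eq, Equiv.coe_addRight, changeProb, stayProb,
    nbrIndex_rotate, rotate_apply]
  congr

lemma IsStationary.rotate {ρ : Config N → ℝ} (h : IsStationary (transP p) ρ) (c : Fin N) :
    IsStationary (transP p) fun x => ρ (rotate c x) := by
  obtain ⟨h1, h2, h3⟩ := isStationary_iff.1 h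
  refine isStationary_iff.2 ⟨fun x => h1 _, ?_, fun y => ?_⟩
  · rw [← h2]; exact Equiv.sum_comp (Parrondo.rotate c) ρ
  · refine Eq.trans ?_ ((Equiv.sum_comp (Parrondo.rotate c) _).trans (h3 _))
    simp only [transP_rotate]

/-- Mean profit of player `i` when playing. -/
noncomputable def playerProfit (p : Fin 4 → ℝ) (ρ : Config N → ℝ) (i : Fin N) : ℝ :=
  ∑ x, ρ x * (p (nbrIndex x i) - (1 - p (nbrIndex x i)))

section Invariant

variable {ρ : Config N → ℝ}

lemma marginalPair_eq_of_rotate (hinv : ∀ c x, ρ (rotate c x) = ρ x)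
    (i j : Fin N) (u v : Fin 2) :
    marginalPair ρ i (i + 2) u v = marginalPair ρ j (j + 2) u v := by
  unfold marginalPair
  rw [← Equiv.sum_comp (rotate (j - i))]
  refine Finset.sum_congr rfl fun x _ => ?_
  rw [hinv, rotate_apply, rotate_apply, add_right_comm, add_sub_cancel]

lemma playerProfit_eq_of_rotate (hinv : ∀ c x, ρ (rotate c x) = ρ x)
    (p : Fin 4 → ℝ) (i j : Fin N) :
    playerProfit p ρ i = playerProfit p ρ j := by
  unfold playerProfit
  rw [← Equiv.sum_comp (rotate (j - i))]
  refine Finset.sum_congr rfl fun x _ => ?_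
  rw [hinv, nbrIndex_rotate, add_sub_cancel]

lemma meanProfit_eq_playerProfit (hinv : ∀ c x, ρ (rotate c x) = ρ x)
    (p : Fin 4 → ℝ) (i : Fin N) :
    meanProfit p ρ = playerProfit p ρ i := by
  have : meanProfit p ρ = (N : ℝ)⁻¹ * ∑ j, playerProfit p ρ j := by
    simp only [meanProfit, playerProfit, Finset.mul_sum]
    rw [Finset.sum_comm]
  rw [this, Finset.sum_congr rfl fun j _ => playerProfit_eq_of_rotate hinv p j i,
    natCast_inv_mul_sum_const]

end Invariant

lemma add_one_add_one (i : Fin N) : i + 1 + 1 = i + 2 := by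
  rw [add_assoc]
  congr 1
  ext
  simp [Fin.val_add]

lemma playerProfit_eq_sum_marginalPair (p : Fin 4 → ℝ) (ρ : Config N → ℝ) (i : Fin N) :
    playerProfit p ρ (i + 1) = ∑ u : Fin 2, ∑ v : Fin 2, marginalPair ρ i (i + 2) u v *
      (p (pairIndex u v) - (1 - p (pairIndex u v))) := by
  simp only [marginalPair, Finset.sum_mul, playerProfit, Fin.sum_univ_two,
    ← Finset.sum_add_distrib, nbrIndex, add_sub_cancel_right, add_one_add_one]
  refine Finset.sum_congr rfl fun x _ => ?_
  rcases Fin.exists_fin_two.1 ⟨x i, rfl⟩ with h | h <;>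
    rcases Fin.exists_fin_two.1 ⟨x (i + 2), rfl⟩ with h' | h' <;> simp [h, h']

/-- Stationarity is tested on the indicator of `x i = 1`: whatever the old status, once `i` plays
the new one is 1 with probability `p (nbrIndex x i)`. -/
lemma IsStationary.sum_mul_win {ρ : Config N → ℝ} (h : IsStationary (transP p) ρ) (i : Fin N) :
    ∑ x, ρ x * p (nbrIndex x i) = marginal ρ i 1 := by
  have hN : (N : ℝ) ≠ 0 := Nat.cast_ne_zero.2 (NeZero.ne N)
  set f : Config N → ℝ := fun x => if x i = 1 then 1 else 0 with hf
  have hstep : ∀ x, ∑ y, transP p x y * f y = f x + (N : ℝ)⁻¹ * (p (nbrIndex x i) - f x) := by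
    intro x
    rw [sum_transP_mul]
    have : ∀ j, changeProb p x j * f (flipAt x j) + stayProb p x j * f x =
        f x + if j = i then p (nbrIndex x i) - f x else 0 := by
      intro j
      by_cases hj : j = i
      · subst hj
        simp only [hf, flipAt_self, if_true, changeProb, stayProb]
        rcases Fin.exists_fin_two.1 ⟨x j, rfl⟩ with h | h <;> simp [h]
      · have hs : f (flipAt x j) = f x := by
          simp only [hf, flipAt_of_ne x (Ne.symm hj)]
        rw [hs, ← add_mul, changeProb_add_stayProb, one_mul, if_neg hj, add_zero]
    simp only [this, Finset.sum_add_distrib, mul_add, natCast_inv_mul_sum_const]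
    simp
  have h1 := h.sum_mul f
  simp only [hstep, mul_add, Finset.sum_add_distrib] at h1
  have h2 : (N : ℝ)⁻¹ * ∑ x, ρ x * (p (nbrIndex x i) - f x) = 0 := by
    rw [Finset.mul_sum]
    simp only [mul_left_comm (N : ℝ)⁻¹]
    linarith
  have h3 := (mul_eq_zero.1 h2).resolve_left (inv_ne_zero hN)
  simp only [mul_sub, Finset.sum_sub_distrib] at h3
  rw [sub_eq_zero.1 h3]
  simp [marginal, hf]

lemma IsStationary.playerProfit_eq {ρ : Config N → ℝ} (h : IsStationary (transP p) ρ)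
    (i : Fin N) : playerProfit p ρ i = marginal ρ i 1 - marginal ρ i 0 := by
  have h1 : marginal ρ i 0 + marginal ρ i 1 = 1 := by
    rw [← (isStationary_iff.1 h).2.1, marginal, marginal, ← Finset.sum_add_distrib]
    refine Finset.sum_congr rfl fun x _ => ?_
    rcases Fin.exists_fin_two.1 ⟨x i, rfl⟩ with h | h <;> simp [h]
  have h2 : playerProfit p ρ i = 2 * ∑ x, ρ x * p (nbrIndex x i) - ∑ x, ρ x := by
    rw [playerProfit, Finset.mul_sum, ← Finset.sum_sub_distrib]
    exact Finset.sum_congr rfl fun x _ => by ring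
  rw [h2, h.sum_mul_win, (isStationary_iff.1 h).2.1]
  linarith

end StatusChain

/-! ### From convergence along squares to convergence -/

section Limits

/-- Chebyshev and Borel–Cantelli along the squares. -/
lemma ae_tendsto_div_sq {Ω : Type*} [MeasurableSpace Ω] {Pr : Measure Ω} {Z : ℕ → Ω → ℝ} {C : ℝ}
    (hint : ∀ k, Integrable (fun ω => Z k ω ^ 2) Pr)
    (hZ : ∀ k, ∫ ω, Z k ω ^ 2 ∂Pr ≤ C * (k : ℝ) ^ 2) :
    ∀ᵐ ω ∂Pr, Tendsto (fun k : ℕ => Z k ω / (k : ℝ) ^ 2) atTop (𝓝 0) := by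
  have heq : ∀ k ω, (Z k ω / (k : ℝ) ^ 2) ^ 2 = Z k ω ^ 2 * (((k : ℝ) ^ 2) ^ 2)⁻¹ :=
    fun k ω => by rw [div_pow, div_eq_mul_inv]
  have hint' : ∀ k, Integrable (fun ω => (Z k ω / (k : ℝ) ^ 2) ^ 2) Pr := fun k => by
    simp only [heq]
    exact (hint k).mul_const _
  have hbound : ∀ k : ℕ, ∫ ω, (Z k ω / (k : ℝ) ^ 2) ^ 2 ∂Pr ≤ C * ((k : ℝ) ^ 2)⁻¹ := by
    intro k
    simp only [heq, integral_mul_const]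
    rcases Nat.eq_zero_or_pos k with rfl | hk
    · simp
    · have hk : 0 < (k : ℝ) := Nat.cast_pos.2 hk
      calc _ ≤ C * (k : ℝ) ^ 2 * (((k : ℝ) ^ 2) ^ 2)⁻¹ :=
            mul_le_mul_of_nonneg_right (hZ k) (by positivity)
        _ = _ := by field_simp
  -- The sum of squares has finite expectation, so almost surely it converges and its terms tend to
  -- zero.
  have hfin : ∑' k : ℕ, ∫⁻ ω, ENNReal.ofReal ((Z k ω / (k : ℝ) ^ 2) ^ 2) ∂Pr ≠ ⊤ := by
    have hs : Summable fun k : ℕ => C * ((k : ℝ) ^ 2)⁻¹ :=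
      (Real.summable_nat_pow_inv.2 one_lt_two).mul_left C
    refine ne_top_of_le_ne_top hs.tsum_ofReal_ne_top (ENNReal.tsum_le_tsum fun k => ?_)
    rw [← ofReal_integral_eq_lintegral_ofReal (hint' k) (ae_of_all _ fun ω => sq_nonneg _)]
    exact ENNReal.ofReal_le_ofReal (hbound k)
  have hmeas : ∀ k : ℕ, AEMeasurable (fun ω => ENNReal.ofReal ((Z k ω / (k : ℝ) ^ 2) ^ 2)) Pr :=
    fun k => (hint' k).aemeasurable.ennreal_ofReal
  rw [← lintegral_tsum hmeas] at hfin
  filter_upwards [ae_lt_top' (AEMeasurable.tsum hmeas) hfin] with ω hω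
  have h0 := ENNReal.tendsto_atTop_zero_of_tsum_ne_top hω.ne
  have h1 := (ENNReal.tendsto_toReal ENNReal.zero_ne_top).comp h0
  have h2 : Tendsto (fun k : ℕ => (Z k ω / (k : ℝ) ^ 2) ^ 2) atTop (𝓝 0) := by
    simpa [Function.comp_def, ENNReal.toReal_ofReal, sq_nonneg] using h1
  have h3 := h2.sqrt
  simp only [Real.sqrt_sq_eq_abs, Real.sqrt_zero] at h3
  exact (tendsto_zero_iff_abs_tendsto_zero _).2 h3

lemma tendsto_natSqrt_atTop : Tendsto Nat.sqrt atTop atTop :=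
  tendsto_atTop.2 fun b => eventually_atTop.2 ⟨b * b, fun _ h => Nat.le_sqrt.2 h⟩

/-- A sequence with bounded increments is `o(n)` if it is along the squares. -/
lemma tendsto_div_of_tendsto_div_sq {a : ℕ → ℝ} {K : ℝ} (hK : ∀ n, |a (n + 1) - a n| ≤ K)
    (ha : Tendsto (fun k : ℕ => a (k ^ 2) / (k : ℝ) ^ 2) atTop (𝓝 0)) :
    Tendsto (fun n : ℕ => a n / n) atTop (𝓝 0) := by
  have hK0 : 0 ≤ K := (abs_nonneg _).trans (hK 0)
  have hinc : ∀ m n : ℕ, |a (m + n) - a m| ≤ K * n := by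
    intro m n
    induction n with
    | zero => simp
    | succ n ih =>
      calc |a (m + (n + 1)) - a m| = |(a (m + n + 1) - a (m + n)) + (a (m + n) - a m)| := by
            rw [← add_assoc]; congr 1; ring
        _ ≤ _ := abs_add_le _ _
        _ ≤ K + K * n := add_le_add (hK _) ih
        _ = _ := by push_cast; ring
  -- With `k = ⌊√n⌋` one has `n - k ^ 2 ≤ 2 * k`, which costs at most `2 * K * k` on the scale `k ^
  -- 2`.
  have hlim : Tendsto (fun k : ℕ => |a (k ^ 2) / (k : ℝ) ^ 2| + 2 * K / k) atTop (𝓝 0) := by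
    simpa using ha.abs.add (tendsto_const_div_atTop_nhds_zero_nat (2 * K))
  refine squeeze_zero_norm' ?_ (hlim.comp tendsto_natSqrt_atTop)
  filter_upwards [eventually_ge_atTop 1] with n hn
  set k := n.sqrt with hk
  have hk1 : 1 ≤ k := Nat.le_sqrt.2 (by simpa using hn)
  have hle : k ^ 2 ≤ n := Nat.sqrt_le' n
  have hlt : n ≤ k ^ 2 + 2 * k := by have := Nat.sqrt_le_add n; rw [← hk] at this; nlinarith
  have hkR : 0 < (k : ℝ) := Nat.cast_pos.2 hk1
  have hleR : (k : ℝ) ^ 2 ≤ n := by exact_mod_cast hle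
  have h1 : |a n| ≤ |a (k ^ 2)| + K * (2 * k) := by
    have := hinc (k ^ 2) (n - k ^ 2)
    rw [Nat.add_sub_cancel' hle] at this
    have h2 : ((n - k ^ 2 : ℕ) : ℝ) ≤ 2 * k := by
      have : n - k ^ 2 ≤ 2 * k := by omega
      exact_mod_cast this
    have h3 := abs_sub_abs_le_abs_sub (a n) (a (k ^ 2))
    have h4 := mul_le_mul_of_nonneg_left h2 hK0
    linarith
  simp only [Function.comp_apply, ← hk]
  rw [Real.norm_eq_abs, abs_div, abs_div, abs_of_nonneg (by positivity : (0 : ℝ) ≤ (k : ℝ) ^ 2),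
    Nat.abs_cast]
  calc |a n| / n ≤ (|a (k ^ 2)| + K * (2 * k)) / (k : ℝ) ^ 2 := by gcongr
    _ = _ := by field_simp

/-- A monotone function is asymptotic to `t` if it is along the squares. -/
lemma tendsto_div_of_monotone {a : ℝ≥0 → ℝ} (hmono : Monotone a) (ha0 : 0 ≤ a 0)
    (ha : Tendsto (fun k : ℕ => a ((k : ℝ≥0) ^ 2) / (k : ℝ) ^ 2) atTop (𝓝 1)) :
    Tendsto (fun t : ℝ≥0 => a t / t) atTop (𝓝 1) := by
  -- For `k ^ 2 ≤ t ≤ (k + 1) ^ 2` this ratio is the price of replacing `t` by either square.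
  have hratio : Tendsto (fun k : ℕ => ((k : ℝ) / (k + 1)) ^ 2) atTop (𝓝 1) := by
    simpa using (tendsto_natCast_div_add_atTop (1 : ℝ)).pow 2
  have hfloor : Tendsto (fun t : ℝ≥0 => ⌊NNReal.sqrt t⌋₊) atTop atTop :=
    tendsto_nat_floor_atTop.comp NNReal.sqrt.tendsto_atTop
  have hlo : Tendsto (fun k : ℕ => a ((k : ℝ≥0) ^ 2) / (k : ℝ) ^ 2 * ((k : ℝ) / (k + 1)) ^ 2)
      atTop (𝓝 1) := by simpa using ha.mul hratio
  have hhi : Tendsto (fun k : ℕ => a (((k + 1 : ℕ) : ℝ≥0) ^ 2) / ((k + 1 : ℕ) : ℝ) ^ 2 /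
      ((k : ℝ) / (k + 1)) ^ 2) atTop (𝓝 1) := by
    simpa [Function.comp_def, Pi.div_def] using
      (ha.comp (tendsto_add_atTop_nat 1)).div hratio one_ne_zero
  refine tendsto_of_tendsto_of_tendsto_of_le_of_le' (hlo.comp hfloor) (hhi.comp hfloor) ?_ ?_
  all_goals
    filter_upwards [eventually_ge_atTop 1] with t ht
    have hs1 : 1 ≤ NNReal.sqrt t := by
      rw [← NNReal.sqrt_one]; exact NNReal.sqrt_le_sqrt.2 ht
    simp only [Function.comp_apply]
    set k := ⌊NNReal.sqrt t⌋₊ with hk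
    have hk1 : 1 ≤ k := Nat.le_floor (by simpa using hs1)
    have hkR : 0 < (k : ℝ) := Nat.cast_pos.2 hk1
    have hle : (k : ℝ≥0) ^ 2 ≤ t := by
      rw [← NNReal.sq_sqrt t]
      exact pow_le_pow_left₀ zero_le (Nat.floor_le zero_le) 2
    have hlt : t ≤ ((k + 1 : ℕ) : ℝ≥0) ^ 2 := by
      rw [← NNReal.sq_sqrt t]
      refine pow_le_pow_left₀ zero_le ?_ 2
      exact_mod_cast (Nat.lt_floor_add_one (NNReal.sqrt t)).le
    have hleR : (k : ℝ) ^ 2 ≤ t := by exact_mod_cast hle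
    have hltR : (t : ℝ) ≤ ((k : ℝ) + 1) ^ 2 := by exact_mod_cast hlt
    have htR : 0 < (t : ℝ) := lt_of_lt_of_le (by positivity) hleR
    have hm1 := hmono hle
    have hm2 := hmono hlt
    have hp : ∀ s, 0 ≤ a s := fun s => ha0.trans (hmono zero_le)
  · calc _ = a ((k : ℝ≥0) ^ 2) / ((k : ℝ) + 1) ^ 2 := by field_simp
      _ ≤ a t / t := div_le_div₀ (hp t) hm1 htR hltR
  · calc a t / t ≤ a (((k + 1 : ℕ) : ℝ≥0) ^ 2) / (k : ℝ) ^ 2 :=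
          div_le_div₀ (hp _) hm2 (by positivity) hleR
      _ = _ := by push_cast; field_simp

end Limits

/-! ### Law of large numbers for the Poisson process -/

section Poisson

/-- The Poisson variance, from the factorial moments: `(n - r) ^ 2 = n (n - 1) + (1 - 2 r) n + r ^
2`. -/
lemma hasSum_pow_div_factorial_mul_sq (r : ℝ) :
    HasSum (fun n : ℕ => Real.exp (-r) * r ^ n / n.factorial * ((n : ℝ) - r) ^ 2) r := by
  have h0 : HasSum (fun n : ℕ => r ^ n / n.factorial) (Real.exp r) := by
    rw [Real.exp_eq_exp_ℝ]; exact NormedSpace.expSeries_div_hasSum_exp r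
  have h1 : HasSum (fun n : ℕ => r ^ n / n.factorial * n) (r * Real.exp r) := by
    rw [← hasSum_nat_add_iff' 1]
    convert! h0.mul_left r using 1
    · ext n
      rw [Nat.factorial_succ]
      push_cast
      field_simp
      ring
    · simp
  have h2 : HasSum (fun n : ℕ => r ^ n / n.factorial * (n * (n - 1))) (r * (r * Real.exp r)) := by
    rw [← hasSum_nat_add_iff' 1]
    convert! h1.mul_left r using 1
    · ext n
      rw [Nat.factorial_succ]
      push_cast
      field_simp
      ring
    · simp
  have h3 := ((h2.add (h1.mul_left (1 - 2 * r))).add (h0.mul_left (r ^ 2))).mul_left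
    (Real.exp (-r))
  convert! h3 using 1
  · ext n; ring
  · rw [Real.exp_neg]
    field_simp
    ring

lemma integrable_poisson_sub_sq (r : ℝ≥0) :
    Integrable (fun n : ℕ => ((n : ℝ) - r) ^ 2) (poissonMeasure r) := by
  rw [integrable_poissonMeasure_iff]
  simpa using (hasSum_pow_div_factorial_mul_sq r).summable

lemma integral_poisson_sub_sq (r : ℝ≥0) :
    ∫ n : ℕ, ((n : ℝ) - r) ^ 2 ∂poissonMeasure r = r := by
  rw [integral_poissonMeasure]
  exact (hasSum_pow_div_factorial_mul_sq r).tsum_eq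

/-- Strong law of large numbers for the rate one Poisson process. -/
theorem IsPoissonProcess.ae_tendsto_div {Ω : Type*} [MeasurableSpace Ω] {Pr : Measure Ω}
    {T : ℝ≥0 → Ω → ℕ} (h : IsPoissonProcess 1 T Pr) :
    ∀ᵐ ω ∂Pr, Tendsto (fun t : ℝ≥0 => (T t ω : ℝ) / t) atTop (𝓝 1) := by
  have hm : ∀ t, Measurable fun ω => T t ω - T 0 ω := fun t =>
    (h.measurable t).sub (h.measurable 0)
  have hlaw : ∀ t, Pr.map (fun ω => T t ω - T 0 ω) = poissonMeasure t := fun t => by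
    simpa using h.law 0 t zero_le
  have hZ := ae_tendsto_div_sq (Pr := Pr) (C := 1)
    (Z := fun k ω => ((T ((k : ℝ≥0) ^ 2) ω - T 0 ω : ℕ) : ℝ) - (k : ℝ) ^ 2)
    (fun k => by
      have := integrable_poisson_sub_sq ((k : ℝ≥0) ^ 2)
      rw [← hlaw, integrable_map_measure .of_discrete (hm _).aemeasurable] at this
      simpa [Function.comp_def] using this)
    (fun k => by
      have := integral_poisson_sub_sq ((k : ℝ≥0) ^ 2)
      rw [← hlaw, integral_map (hm _).aemeasurable .of_discrete] at this
      simpa using this.le)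
  filter_upwards [hZ, h.zero, h.monotone] with ω h1 h2 h3
  refine tendsto_div_of_monotone (a := fun t => (T t ω : ℝ)) (fun s t hst => ?_)
    (Nat.cast_nonneg _) ?_
  · exact Nat.cast_le.2 (h3 hst)
  · have := h1.add_const 1
    rw [zero_add] at this
    refine this.congr' ?_
    filter_upwards [eventually_ge_atTop 1] with k hk
    have hk : (k : ℝ) ≠ 0 := Nat.cast_ne_zero.2 (by omega)
    rw [h2, Nat.sub_zero]
    field_simp
    ring

end Poisson

/-! ### Law of large numbers for a finite Markov chain -/

section Chain

variable {Ω S : Type*} [MeasurableSpace Ω] [MeasurableSpace S] [Fintype S]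
  [MeasurableSingletonClass S] {Pr : Measure Ω} [IsProbabilityMeasure Pr]
  {P : Matrix S S ℝ} {X : ℕ → Ω → S}

lemma IsMarkovChain.integrable (h : IsMarkovChain P X Pr) (c : S → S → ℝ) (j k : ℕ) :
    Integrable (fun ω => c (X j ω) (X k ω)) Pr := by
  have hm : Measurable fun ω => (X j ω, X k ω) := (h.measurable j).prodMk (h.measurable k)
  have := (Integrable.of_finite (μ := Pr.map fun ω => (X j ω, X k ω))
    (f := fun q : S × S => c q.1 q.2))
  exact this.comp_measurable hm

/-- Given the path up to time `n`, the next state has law `P (X n)`. -/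
lemma IsMarkovChain.integral_path (h : IsMarkovChain P X Pr) (n : ℕ)
    (F : (Fin (n + 1) → S) → S → ℝ) :
    ∫ ω, F (fun k => X k ω) (X (n + 1) ω) ∂Pr =
      ∑ a : Fin (n + 1) → S, Pr.real {ω | (fun k : Fin (n + 1) => X k ω) = a} *
        ∑ b, P (a (Fin.last n)) b * F a b := by
  have hm : Measurable fun ω => ((fun k : Fin (n + 1) => X k ω), X (n + 1) ω) :=
    (measurable_pi_lambda _ fun k : Fin (n + 1) => h.measurable k).prodMk
      (h.measurable _)
  rw [← integral_map (φ := fun ω => ((fun k : Fin (n + 1) => X k ω), X (n + 1) ω))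
    (f := fun q => F q.1 q.2) hm.aemeasurable .of_discrete,
    integral_fintype .of_finite, Fintype.sum_prod_type]
  refine Finset.sum_congr rfl fun a _ => ?_
  rw [Finset.mul_sum]
  refine Finset.sum_congr rfl fun b _ => ?_
  have hmk := h.markov n fun k => if hk : k < n + 1 then a ⟨k, hk⟩ else b
  have e1 : {ω | ∀ k ≤ n, X k ω = if hk : k < n + 1 then a ⟨k, hk⟩ else b} =
      {ω | (fun k : Fin (n + 1) => X k ω) = a} := by
    ext ω
    simp only [Set.mem_ofPred_eq, funext_iff]
    constructor
    · intro H k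
      have := H k (by omega)
      rwa [dif_pos k.isLt] at this
    · intro H k hk
      rw [dif_pos (by omega)]
      exact H ⟨k, by omega⟩
  have e2 : {ω | ∀ k ≤ n + 1, X k ω = if hk : k < n + 1 then a ⟨k, hk⟩ else b} =
      (fun ω => ((fun k : Fin (n + 1) => X k ω), X (n + 1) ω)) ⁻¹' {(a, b)} := by
    ext ω
    simp only [Set.mem_ofPred_eq, Set.mem_preimage, Set.mem_singleton_iff, Prod.mk.injEq,
      funext_iff]
    constructor
    · intro H
      refine ⟨fun k => ?_, ?_⟩
      · have := H k (by omega)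
        rwa [dif_pos k.isLt] at this
      · simpa using H (n + 1) le_rfl
    · rintro ⟨H1, H2⟩ k hk
      split_ifs with hk'
      · exact H1 ⟨k, hk'⟩
      · rw [show k = n + 1 by omega, H2]
  rw [e1, e2] at hmk
  rw [map_measureReal_apply hm (measurableSet_singleton _), hmk, smul_eq_mul]
  simp only [Nat.lt_succ_self, dif_pos, lt_self_iff_false, dif_neg, not_false_eq_true]
  rw [mul_assoc]
  rfl

/-- Orthogonality: since `j + 1 ≤ n`, the path up to time `n` fixes the first factor, and the second
has conditional mean zero. -/
lemma IsMarkovChain.integral_mul_eq_zero (h : IsMarkovChain P X Pr) {d : S → S → ℝ}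
    (hd : ∀ a, ∑ b, P a b * d a b = 0) {j n : ℕ} (hj : j < n) :
    ∫ ω, d (X j ω) (X (j + 1) ω) * d (X n ω) (X (n + 1) ω) ∂Pr = 0 := by
  have := h.integral_path n fun a b =>
    d (a ⟨j, by omega⟩) (a ⟨j + 1, by omega⟩) * d (a (Fin.last n)) b
  refine this.trans (Finset.sum_eq_zero fun a _ => ?_)
  simp only [mul_left_comm (P _ _), ← Finset.mul_sum, hd, mul_zero]

/-- Martingale differences of a finite Markov chain have averages tending to `0`. -/
lemma IsMarkovChain.ae_tendsto_martingale (h : IsMarkovChain P X Pr) {d : S → S → ℝ}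
    (hd : ∀ a, ∑ b, P a b * d a b = 0) :
    ∀ᵐ ω ∂Pr, Tendsto (fun n : ℕ => (∑ k ∈ Finset.range n, d (X k ω) (X (k + 1) ω)) / n)
      atTop (𝓝 0) := by
  obtain ⟨K, hK⟩ : ∃ K : ℝ, ∀ a b, |d a b| ≤ K :=
    ⟨∑ q : S × S, |d q.1 q.2|, fun a b =>
      Finset.single_le_sum (f := fun q : S × S => |d q.1 q.2|) (fun _ _ => abs_nonneg _)
        (Finset.mem_univ (a, b))⟩
  set D : ℕ → Ω → ℝ := fun k ω => d (X k ω) (X (k + 1) ω) with hD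
  set M : ℕ → Ω → ℝ := fun n ω => ∑ k ∈ Finset.range n, D k ω with hM
  have hDm : ∀ k, MemLp (D k) 2 Pr := fun k =>
    MemLp.of_bound (h.integrable d k (k + 1)).aestronglyMeasurable K (ae_of_all _ fun ω => hK _ _)
  have hDD : ∀ j k, Integrable (fun ω => D j ω * D k ω) Pr := fun j k =>
    (hDm j).integrable_mul (hDm k)
  have hMm : ∀ n, MemLp (M n) 2 Pr := fun n => memLp_finsetSum _ fun k _ => hDm k
  have hMsq : ∀ n, Integrable (fun ω => M n ω ^ 2) Pr := fun n => (hMm n).integrable_sq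
  have hcross : ∀ n, ∫ ω, M n ω * D n ω ∂Pr = 0 := by
    intro n
    simp only [hM, Finset.sum_mul]
    rw [integral_finsetSum _ fun k _ => hDD k n]
    exact Finset.sum_eq_zero fun k hk =>
      h.integral_mul_eq_zero hd (Finset.mem_range.1 hk)
  have hvar : ∀ n : ℕ, ∫ ω, M n ω ^ 2 ∂Pr ≤ K ^ 2 * n := by
    intro n
    induction n with
    | zero => simp [hM]
    | succ n ih =>
      have e : ∀ ω, M (n + 1) ω ^ 2 = M n ω ^ 2 + 2 * (M n ω * D n ω) + D n ω ^ 2 := fun ω => by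
        simp only [hM, Finset.sum_range_succ]; ring
      have hD2 : ∫ ω, D n ω ^ 2 ∂Pr ≤ K ^ 2 := by
        have := integral_mono (hDm n).integrable_sq (integrable_const (K ^ 2)) fun ω =>
          sq_le_sq.2 ((hK (X n ω) (X (n + 1) ω)).trans (le_abs_self K))
        simpa using this
      have hc : Integrable (fun ω => 2 * (M n ω * D n ω)) Pr :=
        ((hMm n).integrable_mul (hDm n)).const_mul 2
      simp only [e]
      have hMc : Integrable (fun ω => M n ω ^ 2 + 2 * (M n ω * D n ω)) Pr := (hMsq n).add hc
      rw [integral_add hMc (hDm n).integrable_sq, integral_add (hMsq n) hc,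
        integral_const_mul, hcross]
      push_cast
      linarith
  filter_upwards [ae_tendsto_div_sq (Z := fun k => M (k ^ 2)) (C := K ^ 2)
    (fun k => hMsq _) (fun k => (hvar (k ^ 2)).trans_eq (by rw [Nat.cast_pow]))] with ω hω
  refine tendsto_div_of_tendsto_div_sq (a := fun n => M n ω) (K := K) (fun n => ?_) hω
  simp only [hM, Finset.sum_range_succ, add_sub_cancel_left]
  exact hK _ _

/-- Strong law of large numbers for additive functionals of a finite Markov chain, from a solution
of Poisson's equation. -/
theorem IsMarkovChain.ae_tendsto_average (h : IsMarkovChain P X Pr) {w : S → S → ℝ} {g : S → ℝ}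
    {μ : ℝ} (hd : ∀ a, ∑ b, P a b * (w a b - μ + g b - g a) = 0) :
    ∀ᵐ ω ∂Pr, Tendsto (fun n : ℕ => (n : ℝ)⁻¹ * ∑ k ∈ Finset.range n, w (X k ω) (X (k + 1) ω))
      atTop (𝓝 μ) := by
  filter_upwards [h.ae_tendsto_martingale hd] with ω hω
  -- The increments of `g` telescope, leaving a bounded boundary term.
  have hb : Tendsto (fun n : ℕ => (g (X n ω) - g (X 0 ω)) / n) atTop (𝓝 0) := by
    set K := ∑ a, |g a| with hK
    have hgK : ∀ a, |g a| ≤ K := fun a =>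
      Finset.single_le_sum (f := fun a => |g a|) (fun _ _ => abs_nonneg _) (Finset.mem_univ a)
    refine squeeze_zero_norm (fun n => ?_) (tendsto_const_div_atTop_nhds_zero_nat (K + K))
    rw [Real.norm_eq_abs, abs_div, Nat.abs_cast]
    gcongr
    exact (abs_sub _ _).trans (add_le_add (hgK _) (hgK _))
  have := (hω.sub hb).add_const μ
  rw [sub_zero, zero_add] at this
  refine this.congr' ?_
  filter_upwards [eventually_ge_atTop 1] with n hn
  have hn : (n : ℝ) ≠ 0 := Nat.cast_ne_zero.2 (by omega)
  have hsum : ∑ k ∈ Finset.range n, (w (X k ω) (X (k + 1) ω) - μ + g (X (k + 1) ω) - g (X k ω)) =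
      ∑ k ∈ Finset.range n, w (X k ω) (X (k + 1) ω) - n * μ + (g (X n ω) - g (X 0 ω)) := by
    rw [← Finset.sum_range_sub fun k => g (X k ω)]
    simp only [add_sub_assoc, Finset.sum_add_distrib, Finset.sum_sub_distrib, Finset.sum_const,
      Finset.card_range, nsmul_eq_mul]
  rw [hsum]
  field_simp
  ring

end Chain

/-! ### The profit along the chain on `State N` -/

section Profit

set_option linter.unusedSectionVars false

variable {N : ℕ} [NeZero N] {p : Fin 4 → ℝ}

lemma sum_transPstar_mul (p : Fin 4 → ℝ) (a : State N) (f : State N → ℝ) :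
    ∑ b, transPstar p a b * f b =
      changeProb p a.1 a.2 * ((N : ℝ)⁻¹ * ∑ j, f (flipAt a.1 a.2, j)) +
        stayProb p a.1 a.2 * ((N : ℝ)⁻¹ * ∑ j, f (a.1, j)) := by
  have hne := flipAt_ne a.1 a.2
  have hsplit : ∀ b, transPstar p a b * f b =
      (if b.1 = flipAt a.1 a.2 then (N : ℝ)⁻¹ * changeProb p a.1 a.2 * f b else 0) +
        if b.1 = a.1 then (N : ℝ)⁻¹ * stayProb p a.1 a.2 * f b else 0 := by
    intro b
    unfold transPstar
    by_cases h1 : b.1 = flipAt a.1 a.2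
    · have h2 : b.1 ≠ a.1 := h1 ▸ hne
      rw [if_pos h1, if_pos h1, if_neg h2, add_zero]
    · by_cases h2 : b.1 = a.1
      · rw [if_neg h1, if_pos h2, if_neg h1, if_pos h2, zero_add]
      · rw [if_neg h1, if_neg h2, if_neg h1, if_neg h2, zero_mul, add_zero]
  simp only [hsplit, Finset.sum_add_distrib, Fintype.sum_prod_type]
  congr 1
  · rw [Finset.sum_comm]
    simp only [Finset.sum_ite_eq', Finset.mem_univ, if_true, ← Finset.mul_sum]
    ring
  · rw [Finset.sum_comm]
    simp only [Finset.sum_ite_eq', Finset.mem_univ, if_true, ← Finset.mul_sum]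
    ring

/-- The expected payoff of a turn depends on the configuration around the player only. -/
lemma changeProb_mul_payoff (p : Fin 4 → ℝ) (x : Config N) (i j k : Fin N) :
    changeProb p x i * payoff (x, i) (flipAt x i, j) + stayProb p x i * payoff (x, i) (x, k) =
      p (nbrIndex x i) - (1 - p (nbrIndex x i)) := by
  simp only [payoff, if_true, if_neg (flipAt_ne x i).symm, changeProb, stayProb]
  split_ifs <;> ring

lemma payoff_fst (a : State N) (y : Config N) (j k : Fin N) :
    payoff a (y, j) = payoff a (y, k) := rfl

/-- The strong law of large numbers for the profit of the discrete-time chain. -/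
theorem ae_tendsto_cumProfit {Ω : Type*} [MeasurableSpace Ω] {Pr : Measure Ω}
    [IsProbabilityMeasure Pr] {X : ℕ → Ω → State N} (hX : IsMarkovChain (transPstar p) X Pr)
    {ρ : Config N → ℝ} {g : Config N → ℝ}
    (hg : ∀ x, g x - ∑ y, transP p x y * g y =
      (N : ℝ)⁻¹ * ∑ i, (p (nbrIndex x i) - (1 - p (nbrIndex x i))) - meanProfit p ρ) :
    ∀ᵐ ω ∂Pr, Tendsto (fun n : ℕ => (n : ℝ)⁻¹ * cumProfit X n ω) atTop
      (𝓝 (meanProfit p ρ)) := by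
  set μ := meanProfit p ρ
  -- The lift of `g`: centred expected payoff when player `a.2` plays, plus the expected value of
  -- `g` afterwards. Averaging over a uniform player gives `g` back.
  set G : State N → ℝ := fun a =>
    p (nbrIndex a.1 a.2) - (1 - p (nbrIndex a.1 a.2)) - μ +
      (changeProb p a.1 a.2 * g (flipAt a.1 a.2) + stayProb p a.1 a.2 * g a.1) with hG
  have havg : ∀ x, (N : ℝ)⁻¹ * ∑ j, G (x, j) = g x := by
    intro x
    have := hg x
    rw [sum_transP_mul] at this
    simp only [hG, Finset.sum_add_distrib, Finset.sum_sub_distrib, mul_add, mul_sub,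
      natCast_inv_mul_sum_const] at this ⊢
    linarith
  refine hX.ae_tendsto_average (g := G) fun a => ?_
  obtain ⟨x, i⟩ := a
  rw [sum_transPstar_mul]
  have hc : ∀ (c : ℝ) (y : Config N), (N : ℝ)⁻¹ * ∑ j, (payoff (x, i) (y, j) - μ + G (y, j) - c) =
      payoff (x, i) (y, i) - μ + g y - c := by
    intro c y
    simp only [payoff_fst (x, i) y _ i]
    rw [← havg y]
    simp only [Finset.sum_add_distrib, Finset.sum_sub_distrib, mul_add, mul_sub,
      natCast_inv_mul_sum_const]
  rw [hc, hc]
  have h1 := changeProb_add_stayProb p x i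
  have h2 := changeProb_mul_payoff p x i i i
  simp only [hG]
  linear_combination h2 - (μ + (p (nbrIndex x i) - (1 - p (nbrIndex x i)) - μ +
      (changeProb p x i * g (flipAt x i) + stayProb p x i * g x))) * h1

lemma meanProfit_eq_sum (p : Fin 4 → ℝ) (ρ : Config N → ℝ) :
    meanProfit p ρ =
      ∑ x, ρ x * ((N : ℝ)⁻¹ * ∑ i, (p (nbrIndex x i) - (1 - p (nbrIndex x i)))) := by
  rw [meanProfit, Finset.mul_sum]
  exact Finset.sum_congr rfl fun x _ => mul_left_comm _ _ _

end Profit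

end Parrondo

theorem mainTheorem10 {Ω : Type*} [MeasurableSpace Ω] (Pr : Measure Ω) [IsProbabilityMeasure Pr]
    (N : ℕ) [NeZero N] (hN : 3 ≤ N) (p : Fin 4 → ℝ) (hp : ∀ m, p m ∈ Set.Icc (0 : ℝ) 1)
    (herg : Parrondo.ErgodicityConditions N p)
    (X : ℕ → Ω → Parrondo.State N) (T : ℝ≥0 → Ω → ℕ)
    (hXT : Parrondo.IsContinuousTimeModel p X T Pr) :
    ∃ ρ : Parrondo.Config N → ℝ,
      Parrondo.IsStationary (Parrondo.transP p) ρ ∧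
      (∀ ρ' : Parrondo.Config N → ℝ, Parrondo.IsStationary (Parrondo.transP p) ρ' → ρ' = ρ) ∧
      (∀ᵐ ω ∂Pr, Tendsto (fun t : ℝ≥0 => (t : ℝ)⁻¹ * Parrondo.cumProfitCts X T t ω) atTop
        (𝓝 (Parrondo.meanProfit p ρ))) ∧
      (∀ᵐ ω ∂Pr, Tendsto (fun n : ℕ => (n : ℝ)⁻¹ * Parrondo.cumProfit X n ω) atTop
        (𝓝 (Parrondo.meanProfit p ρ))) ∧
      (∀ (i j : Fin N) (u v : Fin 2),
        Parrondo.marginalPair ρ i (i + 2) u v = Parrondo.marginalPair ρ j (j + 2) u v) ∧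
      (∀ i : Fin N, Parrondo.meanProfit p ρ =
        ∑ u : Fin 2, ∑ v : Fin 2, Parrondo.marginalPair ρ i (i + 2) u v *
          (p (Parrondo.pairIndex u v) - (1 - p (Parrondo.pairIndex u v)))) ∧
      (∀ i : Fin N,
        Parrondo.meanProfit p ρ = Parrondo.marginal ρ i 1 - Parrondo.marginal ρ i 0) := by
  obtain ⟨z, hz⟩ := herg.exists_reach_transP hN hp
  have hnn := Parrondo.transP_nonneg (N := N) hp
  have hrow := Parrondo.sum_transP (N := N) p
  obtain ⟨ρ, hρ⟩ := Parrondo.exists_isStationary hnn hrow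
  have huniq : ∀ ρ', Parrondo.IsStationary (Parrondo.transP p) ρ' → ρ' = ρ :=
    fun ρ' => hρ.unique hnn hrow hz
  -- A rotated stationary law is stationary, hence equal to `ρ`.
  have hinv : ∀ c x, ρ (Parrondo.rotate c x) = ρ x := fun c x =>
    congrFun (huniq _ (hρ.rotate c)) x
  obtain ⟨g, hg⟩ := hρ.exists_poisson hnn hrow hz fun x =>
    (N : ℝ)⁻¹ * ∑ i, (p (Parrondo.nbrIndex x i) - (1 - p (Parrondo.nbrIndex x i)))
  simp only [← Parrondo.meanProfit_eq_sum] at hg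
  have hdisc := Parrondo.ae_tendsto_cumProfit hXT.chain hg
  refine ⟨ρ, hρ, huniq, ?_, hdisc, Parrondo.marginalPair_eq_of_rotate hinv, fun i => ?_,
    fun i => ?_⟩
  · filter_upwards [hdisc, hXT.poisson.ae_tendsto_div] with ω h1 h2
    have hT : Tendsto (fun t : ℝ≥0 => T t ω) atTop atTop := by
      have h3 : Tendsto (fun t : ℝ≥0 => (T t ω : ℝ) / t * t) atTop atTop :=
        h2.pos_mul_atTop one_pos (NNReal.tendsto_coe_atTop.2 tendsto_id)
      refine tendsto_natCast_atTop_iff.1 (h3.congr' ?_)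
      filter_upwards [eventually_gt_atTop 0] with t ht
      exact div_mul_cancel₀ _ (NNReal.coe_ne_zero.2 ht.ne')
    have h4 := h2.mul (h1.comp hT)
    rw [one_mul] at h4
    refine h4.congr' ?_
    filter_upwards [hT.eventually_ge_atTop 1] with t ht
    have ht : (T t ω : ℝ) ≠ 0 := Nat.cast_ne_zero.2 (by omega)
    simp only [Function.comp_apply, Parrondo.cumProfitCts]
    field_simp
  -- Players `i` and `i + 2` are the neighbours of player `i + 1`.
  · rw [Parrondo.meanProfit_eq_playerProfit hinv p (i + 1),
      Parrondo.playerProfit_eq_sum_marginalPair]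
  · rw [Parrondo.meanProfit_eq_playerProfit hinv p i, hρ.playerProfit_eq]
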